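/- Let $\mathcal O:=\{(a,b)\in\mathbb C^2:\ \Re(a)<1,\ \Re(b)<1,\ a+b\neq 1,-1,-3,\dots\}$, let $\mathcal O^c$ be its complement in $\mathbb C^2$, and let $|(a,b)|=(|a|^2+|b|^2)^{1/2}$ and $\operatorname{dist}$ be the Euclidean norm and distance on $\mathbb C^2$. For $\Re(a)<1$, $\Re(b)<1$ and $t>0$ let $$h_{a,b}(t):=\frac1{\sqrt{4\pi t}}\int_0^1\int_0^1 e^{-(x-\tilde x)^2/(4t)}x^{-a}\tilde x^{-b}\,dx\,d\tilde x .$$ Put $\theta_0(a):=1$ and $\theta_n(a):=a(a+1)\cdots(a+n-1)$ for $n\ge1$, and let $$c(a,b):=\frac{2^{-a-b}}{\sqrt\pi}\,\Gamma\Big(\frac{2-a-b}2\Big)\Gamma(a+b-1)\Big(\frac{\Gamma(1-a)}{\Gamma(b)}+\frac{\Gamma(1-b)}{\Gamma(a)}\Big),$$ $$c_n(a,b):=\frac{(\theta_n(a)+\theta_n(b))\,2^{n-1}\,\Gamma\big(\frac{1+n}2\big)}{\sqrt\pi\,(1-a-b-n)\,n!}\qquad(n=0,1,2,\dots).$$ These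 formulas define $c$ at the points of $\mathcal O$ with $a+b\ne0,-2,-4,\dots$ and $c_n$ at the points of $\mathcal O$ with $a+b\neq 1-n$ (with $1/\Gamma$ read as $0$ at the poles of $\Gamma$). Theorem. The functions $c$ and $c_n$ extend holomorphically to all of $\mathcal O$. With $c$ and $c_n$ denoting these extensions, put, for a non-negative integer $N$ and $0<t<1$, $$R_N(a,b):=\Big|h_{a,b}(t)-\Big\{c(a,b)\,t^{(1-a-b)/2}+\sum_{n=0}^N c_n(a,b)\,t^{n/2}\Big\}\Big| .$$ (1) For every non-negative integer $N$ and every $R$ there is a constant $\kappa(N,R)$ such that, whenever $(a,b)\in\mathcal O$, $\Re(a+b)>-7$, $N\ge-\Re(a+b)+3$, $|(a,b)|\le R$, $0<\delta<\frac12$, $\operatorname{dist}((a,b),\mathcal O^c)\ge\delta$ and $0<t<1$, $$R_N(a,b)\le\kappa(N,R)\,(1+\delta^{-4})\,\big\{t^{(N+1)/2}+e^{-1/(36t)}\big\}.$$ (2) For every $(a,b)\in\mathcal O$ with $\Re(a+b)\le-7$ and every non-negative integer $N\ge-\Re(a+b)+3$ there is a constant $\mathcal E_N(a,b)$ such that,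 for all $0<t<1$, $$R_N(a,b)\le\mathcal E_N(a,b)\,t^{(N+1)/2}.$$ -/

import Mathlib

noncomputable section

/-- The parameter domain: pairs `(a, b)` of complex numbers with `Re a < 1`, `Re b < 1` and
`a + b ∉ {1, -1, -3, …}`. -/
def paramDomain : Set (ℂ × ℂ) :=
  {p | p.1.re < 1 ∧ p.2.re < 1 ∧ ∀ k : ℕ, p.1 + p.2 ≠ 1 - 2 * (k : ℂ)}

/-- The Euclidean norm `|(a, b)| = (|a|² + |b|²)^{1/2}` on `ℂ²` (the product type `ℂ × ℂ` itself
carries the sup norm). -/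
def pairNorm (p : ℂ × ℂ) : ℝ := ‖WithLp.toLp 2 p‖

/-- The Euclidean distance from `(a, b)` to the complement of the parameter domain in `ℂ²`. -/
def distToCompl (p : ℂ × ℂ) : ℝ :=
  Metric.infDist (WithLp.toLp 2 p) (WithLp.toLp 2 '' paramDomainᶜ)

/-- The heat content of `[0, 1]` in `ℝ` with initial temperature `x ^ (-a)` and specific heat
`y ^ (-b)`. -/
def heatContent (a b : ℂ) (t : ℝ) : ℂ :=
  ((1 / Real.sqrt (4 * Real.pi * t) : ℝ) : ℂ) *
    ∫ y in (0 : ℝ)..1, ∫ x in (0 : ℝ)..1,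
      (Real.exp (-(x - y) ^ 2 / (4 * t)) : ℂ) * (x : ℂ) ^ (-a) * (y : ℂ) ^ (-b)

/-- `θ_n(a) = a (a + 1) ⋯ (a + n - 1)`, with `θ_0(a) = 1`. -/
def theta (n : ℕ) (a : ℂ) : ℂ := ∏ j ∈ Finset.range n, (a + (j : ℂ))

/-- The explicit formula for `c(a, b)`, meaningful on the parameter domain wherever
`Γ(a + b - 1)` has no pole, that is for `a + b ∉ {0, -2, -4, …}`. The quotients by `Γ(b)` and
`Γ(a)` are correct at the poles of these too: `Complex.Gamma` is `0` there, and so is the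
quotient, as it should be because `1 / Γ` vanishes there. -/
def cFormula (a b : ℂ) : ℂ :=
  (2 : ℂ) ^ (-a - b) * (1 / (Real.sqrt Real.pi : ℂ)) * Complex.Gamma ((2 - a - b) / 2) *
    Complex.Gamma (a + b - 1) *
      (Complex.Gamma (1 - a) / Complex.Gamma b + Complex.Gamma (1 - b) / Complex.Gamma a)

/-- The explicit formula for `c_n(a, b)`, meaningful where `1 - a - b - n ≠ 0`. -/
def cnFormula (n : ℕ) (a b : ℂ) : ℂ :=
  (theta n a + theta n b) * (2 : ℂ) ^ ((n : ℤ) - 1) * Complex.Gamma ((1 + (n : ℂ)) / 2) /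
    ((Real.sqrt Real.pi : ℂ) * (1 - a - b - (n : ℂ)) * (n.factorial : ℂ))

/-- `R_N(a, b)` at time `t`, for given coefficient functions `c` and `c_n`. -/
def remainder (c : ℂ × ℂ → ℂ) (cn : ℕ → ℂ × ℂ → ℂ) (N : ℕ) (a b : ℂ) (t : ℝ) : ℝ :=
  ‖heatContent a b t -
    (c (a, b) * (t : ℂ) ^ ((1 - a - b) / 2) +
      ∑ n ∈ Finset.range (N + 1), cn n (a, b) * (t : ℂ) ^ ((n : ℂ) / 2))‖

end

/-!
The heat content is computed exactly as a series, from which the expansion and its error can be read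
off. Write `s = a + b`, `p_n(b) = θ_n(b) / n!` for the binomial coefficients of `(1 - x) ^ (-b)`,
and `g(z) = exp (-z² / (4t))`.

Split the unit square along its diagonal and put `x = y (1 - u)` in the triangle `x < y`. The double
integral becomes `∬ y ^ (1 - s) (1 - u) ^ (-a) g(yu)`, plus the same with `b` in place of `a`, and
expanding the binomial gives `∑ (p_n(a) + p_n(b)) m_n` with moments
`m_n = ∬ y ^ (1 - s) u ^ n g(yu)` (`hasSum_triangleIntegral`). The fundamental theorem of calculus
evaluates `(1 - s - n) m_n = ∫_0^1 (z ^ n - z ^ (1 - s)) g(z) dz` (`mul_squareMoment`). Hence, with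
`d_n = (p_n(a) + p_n(b)) / (1 - s - n)`,

  `√(4πt) h_{a,b}(t) = ∑ d_n ∫_0^1 (z ^ n - z ^ (1 - s)) g(z) dz`

(`hasSum_coeff_mul_truncMoment`). For odd `n` the zero of `1 - s - n` is cancelled by the numerator,
so `d_n` is holomorphic on the whole domain (`coeff`).

Replacing `∫_0^1` by `∫_0^∞` for `z ^ (1 - s)` and for `z ^ n`, `n ≤ N`, gives the terms of the
expansion. Each replacement, and each dropped term `n > N`, costs at most
`∫_0^∞ z ^ (N + 1) g(z) dz`, so the whole error is at most `2 ∑ |d_n|` times a constant multiple of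
`t ^ ((N + 1) / 2)` (`norm_heatContent_sub_le`). At distance `δ` from the complement of the domain,
`∑ |d_n|` is `O(1 / δ)` uniformly on bounded sets: the `p_n` are, up to a
constant, dominated by `∏_{j < n} (1 - δ / (j + 1))`, whose sum against `1 / (n + 1)`
telescopes (`exists_majorant_coeff`).

The coefficient of `t ^ ((1 - s) / 2)` is `-∑ d_n` times `momentConst (1 - s)`. The series
`∑ p_n(b) / (n + w)` is the beta function `Γ(w) Γ(1 - b) / Γ(w + 1 - b)` (`tsum_binCoeff_div`),
which at `w = s - 1` gives the stated formula; by reflection and duplication it simplifies to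
`Γ((s - 1) / 2) Γ(1 - a) Γ(1 - b) cos (π (a - b) / 2) / (2π)`, holomorphic on the domain (`cExt`).
On the lines `s = 0, -2, …` the identity persists by continuity
(`neg_tsum_coeff_mul_momentConst_eq_cExt`).
-/

namespace HeatContent

open MeasureTheory Filter Topology

/-! ### The binomial coefficients `θ_n(b) / n!` -/

/-- The coefficient of `x ^ n` in the binomial series of `(1 - x) ^ (-b)`. -/
noncomputable def binCoeff (n : ℕ) (b : ℂ) : ℂ := theta n b / (n.factorial : ℂ)

lemma theta_succ (n : ℕ) (b : ℂ) : theta (n + 1) b = theta n b * (b + n) := by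
  simp [theta, Finset.prod_range_succ]

lemma binCoeff_zero (b : ℂ) : binCoeff 0 b = 1 := by simp [binCoeff, theta]

lemma binCoeff_succ (n : ℕ) (b : ℂ) :
    binCoeff (n + 1) b = binCoeff n b * ((b + n) / ((n : ℂ) + 1)) := by
  have h1 : (n : ℂ) + 1 ≠ 0 := Nat.cast_add_one_ne_zero n
  have h2 : (n.factorial : ℂ) ≠ 0 := by exact_mod_cast n.factorial_ne_zero
  simp only [binCoeff, theta_succ, Nat.factorial_succ]
  push_cast
  field_simp

lemma theta_eq_ascPochhammer (n : ℕ) (b : ℂ) : theta n b = (ascPochhammer ℂ n).eval b := by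
  induction n with
  | zero => simp [theta]
  | succ n ih => rw [theta_succ, ascPochhammer_succ_eval, ih]

lemma binCoeff_eq_choose (n : ℕ) (b : ℂ) : binCoeff n b = Ring.choose (b + n - 1) n := by
  have h2 : (n.factorial : ℂ) ≠ 0 := by exact_mod_cast n.factorial_ne_zero
  have h := Ring.factorial_nsmul_multichoose_eq_ascPochhammer b n
  rw [Polynomial.ascPochhammer_smeval_eq_eval, ← theta_eq_ascPochhammer, nsmul_eq_mul] at h
  rw [← Ring.multichoose_eq, binCoeff, ← h]
  field_simp

lemma hasSum_binCoeff_mul_pow (b : ℂ) {x : ℂ} (hx : ‖x‖ < 1) :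
    HasSum (fun n => binCoeff n b * x ^ n) ((1 - x) ^ (-b)) := by
  have h := (Complex.one_div_one_sub_cpow_hasFPowerSeriesOnBall_zero b).hasSum (y := x)
    (by simpa [enorm_eq_nnnorm, ← NNReal.coe_lt_coe] using hx)
  simp only [FormalMultilinearSeries.ofScalars_apply_eq, zero_add, smul_eq_mul,
    ← binCoeff_eq_choose] at h
  rwa [Complex.cpow_neg, ← one_div]

/-- The products `∏_{j < n} (1 - δ / (j + 1))`, of size `n ^ (-δ)`, which dominate the binomial
coefficients of `(1 - x) ^ (-b)` for `Re b ≤ 1 - δ`. -/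
noncomputable def decay (δ : ℝ) (n : ℕ) : ℝ := ∏ j ∈ Finset.range n, (1 - δ / ((j : ℝ) + 1))

lemma decay_factor_pos {δ : ℝ} (hδ : δ < 1) (j : ℕ) : 0 < 1 - δ / ((j : ℝ) + 1) := by
  have : (0 : ℝ) < j + 1 := by positivity
  rw [sub_pos, div_lt_one this]
  have : (0 : ℝ) ≤ j := by positivity
  linarith

lemma decay_pos {δ : ℝ} (hδ : δ < 1) (n : ℕ) : 0 < decay δ n :=
  Finset.prod_pos fun j _ => decay_factor_pos hδ j

lemma decay_succ (δ : ℝ) (n : ℕ) : decay δ (n + 1) = decay δ n * (1 - δ / ((n : ℝ) + 1)) := by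
  simp [decay, Finset.prod_range_succ]

/-- The terms telescope: `δ * decay δ n / (n + 1) = decay δ n - decay δ (n + 1)`. -/
lemma sum_decay_div_le {δ : ℝ} (h0 : 0 < δ) (hδ : δ < 1) (m : ℕ) :
    ∑ n ∈ Finset.range m, decay δ n / ((n : ℝ) + 1) ≤ 1 / δ := by
  have h : ∀ n : ℕ, decay δ n / ((n : ℝ) + 1) = (decay δ n - decay δ (n + 1)) / δ := by
    intro n
    have : (0 : ℝ) < n + 1 := by positivity
    rw [decay_succ]
    field_simp
    ring
  simp only [h]
  rw [← Finset.sum_div, Finset.sum_range_sub']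
  have := decay_pos hδ m
  gcongr
  simp only [decay, Finset.range_zero, Finset.prod_empty]
  change 1 - decay δ m ≤ 1
  linarith

lemma summable_decay_div {δ : ℝ} (h0 : 0 < δ) (hδ : δ < 1) :
    Summable fun n : ℕ => decay δ n / ((n : ℝ) + 1) :=
  summable_of_sum_range_le (fun n => by have := decay_pos hδ n; positivity)
    (sum_decay_div_le h0 hδ)

lemma tsum_decay_div_le {δ : ℝ} (h0 : 0 < δ) (hδ : δ < 1) :
    ∑' n : ℕ, decay δ n / ((n : ℝ) + 1) ≤ 1 / δ :=
  Real.tsum_le_of_sum_range_le (fun n => by have := decay_pos hδ n; positivity)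
    (sum_decay_div_le h0 hδ)

lemma norm_add_natCast_le {b : ℂ} {R δ : ℝ} (hR : ‖b‖ ≤ R) (hδ : δ ≤ 1 / 2)
    (hb : b.re ≤ 1 - δ) (j : ℕ) :
    ‖b + j‖ ≤ ((j : ℝ) + 1 - δ) * (1 + 4 * R ^ 2 / ((j : ℝ) + 1) ^ 2) := by
  have hj : (0 : ℝ) ≤ j := j.cast_nonneg
  have hR0 : 0 ≤ R := (norm_nonneg b).trans hR
  have hbsq : b.re ^ 2 + b.im ^ 2 ≤ R ^ 2 := by
    calc b.re ^ 2 + b.im ^ 2 = ‖b‖ ^ 2 := by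
          rw [← Complex.normSq_eq_norm_sq, Complex.normSq_apply]; ring
      _ ≤ R ^ 2 := by gcongr
  have hsq : ‖b + j‖ ^ 2 = (b.re + j) ^ 2 + b.im ^ 2 := by
    rw [← Complex.normSq_eq_norm_sq, Complex.normSq_apply]
    simp; ring
  have key : ‖b + j‖ ^ 2 ≤ ((j : ℝ) + 1 - δ) ^ 2 + R ^ 2 := by
    rw [hsq]
    -- if `b.re + j < 0`, then `|b.re + j| ≤ |b.re|` and so `‖b + j‖ ≤ ‖b‖`
    rcases le_or_gt 0 (b.re + j) with h | h
    · nlinarith [sq_nonneg b.re]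
    · nlinarith [sq_nonneg ((j : ℝ) + 1 - δ), sq_nonneg b.re]
  have hm : ((j : ℝ) + 1) / 2 ≤ (j : ℝ) + 1 - δ := by linarith
  set m := (j : ℝ) + 1 - δ
  have hm0 : 0 < m := by linarith
  have hx : R ^ 2 ≤ m ^ 2 * (4 * R ^ 2 / ((j : ℝ) + 1) ^ 2) := by
    have : (((j : ℝ) + 1) / 2) ^ 2 ≤ m ^ 2 := by gcongr
    calc R ^ 2 = (((j : ℝ) + 1) / 2) ^ 2 * (4 * R ^ 2 / ((j : ℝ) + 1) ^ 2) := by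
          field_simp; ring
      _ ≤ _ := by gcongr
  set x := 4 * R ^ 2 / ((j : ℝ) + 1) ^ 2
  have hx0 : 0 ≤ x := by positivity
  refine le_of_sq_le_sq ?_ (by positivity)
  nlinarith [sq_nonneg x, mul_nonneg (sq_nonneg m) hx0, mul_nonneg (sq_nonneg m) (sq_nonneg x)]

/-- The uniform domination of the binomial coefficients: the factors `1 + O(1 / (j + 1)²)` lost in
comparing `|b + j|` with `j + 1 - δ` have a bounded product. -/
lemma norm_binCoeff_le {b : ℂ} {R δ : ℝ} (hR : ‖b‖ ≤ R) (hδ : δ ≤ 1 / 2)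
    (hb : b.re ≤ 1 - δ) (n : ℕ) :
    ‖binCoeff n b‖ ≤ Real.exp (4 * R ^ 2 * ∑' j : ℕ, 1 / ((j : ℝ) + 1) ^ 2) * decay δ n := by
  have hs : Summable fun j : ℕ => 1 / ((j : ℝ) + 1) ^ 2 := by
    simpa using (summable_nat_add_iff 1).2 (Real.summable_one_div_nat_pow.2 one_lt_two)
  have key : ‖binCoeff n b‖ ≤
      Real.exp (4 * R ^ 2 * ∑ j ∈ Finset.range n, 1 / ((j : ℝ) + 1) ^ 2) * decay δ n := by
    induction n with
    | zero => simp [binCoeff_zero, decay]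
    | succ n ih =>
      rw [binCoeff_succ, norm_mul, norm_div, Finset.sum_range_succ, mul_add, Real.exp_add,
        decay_succ]
      have hn : (0 : ℝ) < n + 1 := by positivity
      have h1 : ‖(n : ℂ) + 1‖ = (n : ℝ) + 1 := by
        rw [← Nat.cast_add_one, Complex.norm_natCast]; push_cast; rfl
      have h2 : ‖b + n‖ / ((n : ℝ) + 1) ≤
          Real.exp (4 * R ^ 2 * (1 / ((n : ℝ) + 1) ^ 2)) * (1 - δ / ((n : ℝ) + 1)) := by
        rw [div_le_iff₀ hn]
        refine (norm_add_natCast_le hR hδ hb n).trans ?_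
        have h3 : (0 : ℝ) ≤ (n : ℝ) + 1 - δ := by linarith [(n.cast_nonneg : (0 : ℝ) ≤ n)]
        calc ((n : ℝ) + 1 - δ) * (1 + 4 * R ^ 2 / ((n : ℝ) + 1) ^ 2)
            ≤ ((n : ℝ) + 1 - δ) * Real.exp (4 * R ^ 2 * (1 / ((n : ℝ) + 1) ^ 2)) := by
              gcongr
              rw [mul_one_div, add_comm]
              exact Real.add_one_le_exp _
          _ = _ := by field_simp
      rw [h1]
      calc _ ≤ (Real.exp (4 * R ^ 2 * ∑ j ∈ Finset.range n, 1 / ((j : ℝ) + 1) ^ 2) * decay δ n) *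
            (Real.exp (4 * R ^ 2 * (1 / ((n : ℝ) + 1) ^ 2)) * (1 - δ / ((n : ℝ) + 1))) := by
            gcongr
            exact (norm_nonneg _).trans ih
        _ = _ := by ring
  refine key.trans ?_
  have := decay_pos (show δ < 1 by linarith) n
  gcongr
  exact hs.sum_le_tsum _ fun j _ => by positivity

lemma summable_norm_binCoeff_div {b : ℂ} (hb : b.re < 1) :
    Summable fun n : ℕ => ‖binCoeff n b‖ / ((n : ℝ) + 1) := by
  have h0 : 0 < min (1 - b.re) (1 / 2) := lt_min (by linarith) (by norm_num)
  have h1 : min (1 - b.re) (1 / 2) ≤ 1 / 2 := min_le_right _ _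
  refine Summable.of_nonneg_of_le (fun n => by positivity) (fun n => ?_)
    ((summable_decay_div h0 (by linarith)).mul_left
      (Real.exp (4 * ‖b‖ ^ 2 * ∑' j : ℕ, 1 / ((j : ℝ) + 1) ^ 2)))
  rw [← mul_div_assoc]
  gcongr
  exact norm_binCoeff_le le_rfl h1 (by linarith [min_le_left (1 - b.re) (1 / 2)]) n

/-- The products decrease to a limit, which is zero because their sum against `1 / (n + 1)`
converges. -/
lemma tendsto_decay {δ : ℝ} (h0 : 0 < δ) (hδ : δ < 1) :
    Tendsto (decay δ) atTop (𝓝 0) := by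
  have hanti : Antitone (decay δ) := antitone_nat_of_succ_le fun n => by
    rw [decay_succ]
    refine mul_le_of_le_one_right (decay_pos hδ n).le ?_
    have : 0 ≤ δ / ((n : ℝ) + 1) := by positivity
    linarith
  have hbdd : BddBelow (Set.range (decay δ)) :=
    ⟨0, by rintro _ ⟨n, rfl⟩; exact (decay_pos hδ n).le⟩
  have hlim := tendsto_atTop_ciInf hanti hbdd
  set l := ⨅ n, decay δ n
  have hl0 : 0 ≤ l := le_ciInf fun n => (decay_pos hδ n).le
  rcases hl0.eq_or_lt with h | h
  · rwa [← h] at hlim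
  · exfalso
    have hs : Summable fun n : ℕ => 1 / ((n : ℝ) + 1) := by
      refine Summable.of_nonneg_of_le (fun n => by positivity) (fun n => ?_)
        ((summable_decay_div h0 hδ).mul_left (1 / l))
      have : l ≤ decay δ n := ciInf_le hbdd n
      rw [← mul_div_assoc]
      gcongr
      rw [one_div, inv_mul_eq_div, le_div_iff₀ h]
      linarith
    refine Real.not_summable_one_div_natCast ((summable_nat_add_iff 1).1 ?_)
    simpa using hs

lemma tendsto_binCoeff {b : ℂ} (hb : b.re < 1) :
    Tendsto (fun n => binCoeff n b) atTop (𝓝 0) := by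
  have h0 : 0 < min (1 - b.re) (1 / 2) := lt_min (by linarith) (by norm_num)
  have h1 : min (1 - b.re) (1 / 2) ≤ 1 / 2 := min_le_right _ _
  refine squeeze_zero_norm
    (fun n => norm_binCoeff_le le_rfl h1 (by linarith [min_le_left (1 - b.re) (1 / 2)]) n) ?_
  have h := (tendsto_decay h0 (by linarith)).const_mul
    (Real.exp (4 * ‖b‖ ^ 2 * ∑' j : ℕ, 1 / ((j : ℝ) + 1) ^ 2))
  rwa [mul_zero] at h

/-! ### The coefficients of the expansion -/

/-- The divided difference `(θ_n(x) - θ_n(y)) / (x - y)`, as a polynomial in `x` and `y`. -/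
noncomputable def thetaSlope : ℕ → ℂ → ℂ → ℂ
  | 0, _, _ => 0
  | n + 1, x, y => thetaSlope n x y * (x + n) + theta n y

lemma theta_sub_theta (n : ℕ) (x y : ℂ) :
    theta n x - theta n y = (x - y) * thetaSlope n x y := by
  induction n with
  | zero => simp [theta, thetaSlope]
  | succ n ih =>
    rw [theta_succ, theta_succ, thetaSlope]
    linear_combination (x + n) * ih

lemma theta_reflect (n : ℕ) (a : ℂ) : theta n (1 - n - a) = (-1) ^ n * theta n a := by
  have h : ((-1 : ℂ)) ^ n = ∏ _j ∈ Finset.range n, (-1) := by simp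
  rw [theta, ← Finset.prod_range_reflect, theta, h, ← Finset.prod_mul_distrib]
  refine Finset.prod_congr rfl fun j hj => ?_
  have : j + 1 ≤ n := Finset.mem_range.1 hj
  rw [Nat.sub_sub, Nat.add_comm 1 j, Nat.cast_sub this]
  push_cast
  ring

lemma differentiable_theta (n : ℕ) : Differentiable ℂ (theta n) := by
  unfold theta
  fun_prop

lemma differentiable_thetaSlope (n : ℕ) :
    Differentiable ℂ fun p : ℂ × ℂ => thetaSlope n p.1 p.2 := by
  induction n with
  | zero => simp [thetaSlope]
  | succ n ih =>
    have := differentiable_theta n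
    simp only [thetaSlope]
    fun_prop

/-- The coefficient of `z ^ n` in the small-`z` expansion of
`∬_{|x - y| = z} x ^ (-a) y ^ (-b)`: the holomorphic extension of
`(θ_n(a) + θ_n(b)) / (n! (1 - a - b - n))`. For odd `n` the numerator vanishes on the line
`a + b = 1 - n`, since `θ_n(1 - n - a) = -θ_n(a)`, and the quotient is a polynomial, given by a
divided difference; for even `n` the line is not in the parameter domain. -/
noncomputable def coeff (n : ℕ) (p : ℂ × ℂ) : ℂ :=
  if Even n then (binCoeff n p.1 + binCoeff n p.2) / (1 - p.1 - p.2 - n)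
  else -(thetaSlope n p.2 (1 - n - p.1)) / (n.factorial : ℂ)

lemma one_sub_sub_ne_zero_of_even {a b : ℂ} (h : (a, b) ∈ paramDomain) {n : ℕ} (hn : Even n) :
    1 - a - b - n ≠ 0 := by
  obtain ⟨k, rfl⟩ := hn
  intro h0
  refine h.2.2 k ?_
  push_cast at h0
  linear_combination -h0

lemma mul_coeff {a b : ℂ} (h : (a, b) ∈ paramDomain) (n : ℕ) :
    (1 - a - b - n) * coeff n (a, b) = binCoeff n a + binCoeff n b := by
  have hf : (n.factorial : ℂ) ≠ 0 := by exact_mod_cast n.factorial_ne_zero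
  unfold coeff
  split_ifs with hn
  · have := one_sub_sub_ne_zero_of_even h hn
    simp only
    field_simp
  · have h1 := theta_sub_theta n b (1 - n - a)
    rw [theta_reflect, (Nat.not_even_iff_odd.1 hn).neg_one_pow] at h1
    simp only [binCoeff]
    field_simp
    linear_combination -h1

lemma differentiableOn_coeff (n : ℕ) : DifferentiableOn ℂ (coeff n) paramDomain := by
  have h1 := differentiable_theta n
  unfold coeff
  split_ifs with hn
  · simp only [binCoeff]
    have h2 : Differentiable ℂ fun p : ℂ × ℂ =>
        theta n p.1 / (n.factorial : ℂ) + theta n p.2 / (n.factorial : ℂ) := by fun_prop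
    have h3 : Differentiable ℂ fun p : ℂ × ℂ => 1 - p.1 - p.2 - (n : ℂ) := by fun_prop
    simp only [div_eq_mul_inv]
    simp only [div_eq_mul_inv] at h2
    refine h2.differentiableOn.mul (h3.differentiableOn.inv ?_)
    rintro ⟨a, b⟩ h
    exact one_sub_sub_ne_zero_of_even h hn
  · have h2 : Differentiable ℂ fun p : ℂ × ℂ => thetaSlope n p.2 (1 - n - p.1) :=
      (differentiable_thetaSlope n).comp
        (show Differentiable ℂ fun p : ℂ × ℂ => (p.2, 1 - (n : ℂ) - p.1) by fun_prop)
    exact Differentiable.differentiableOn (by fun_prop)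

lemma decay_le_one {δ : ℝ} (h0 : 0 < δ) (hδ : δ < 1) (n : ℕ) : decay δ n ≤ 1 :=
  Finset.prod_le_one (fun j _ => (decay_factor_pos hδ j).le) fun j _ => by
    have : 0 ≤ δ / ((j : ℝ) + 1) := by positivity
    linarith

/-- The part of the parameter domain, bounded by `R` and at distance at least `δ` from the boundary
hyperplanes, on which the estimates are uniform. -/
structure InRegion (R δ : ℝ) (a b : ℂ) : Prop where
  norm_left : ‖a‖ ≤ R
  norm_right : ‖b‖ ≤ R
  re_left : a.re ≤ 1 - δ
  re_right : b.re ≤ 1 - δ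
  le_norm : ∀ k : ℕ, δ ≤ ‖1 - a - b - 2 * (k : ℂ)‖

lemma InRegion.mem {R δ : ℝ} {a b : ℂ} (h : InRegion R δ a b) (h0 : 0 < δ) :
    (a, b) ∈ paramDomain := by
  refine ⟨by simpa using h.re_left.trans_lt (by linarith),
    by simpa using h.re_right.trans_lt (by linarith), fun k hk => ?_⟩
  have h1 := h.le_norm k
  have h2 : 1 - a - b - 2 * (k : ℂ) = 0 := by linear_combination -hk
  rw [h2, norm_zero] at h1
  linarith

/-- The coefficients have a summable majorant, uniform on each region. The finitely many indices at
which `1 - a - b - n` can be small cost a factor `1 / δ` (even `n`) or nothing (odd `n`), and the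
remaining terms are dominated by the telescoping series of `decay δ n / (n + 1)`. -/
lemma exists_majorant_coeff (R : ℝ) : ∃ C : ℝ, ∀ δ : ℝ, 0 < δ → δ < 1 / 2 →
    ∃ u : ℕ → ℝ, Summable u ∧ ∑' n, u n ≤ C / δ ∧
      ∀ a b : ℂ, InRegion R δ a b → ∀ n, ‖coeff n (a, b)‖ ≤ u n := by
  set K := Real.exp (4 * R ^ 2 * ∑' j : ℕ, 1 / ((j : ℝ) + 1) ^ 2)
  have hK : 0 < K := Real.exp_pos _
  -- for `n ≥ 4 R + 3` the denominator satisfies `|1 - a - b - n| ≥ (n + 1) / 2`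
  obtain ⟨M, hM⟩ := exists_nat_ge (4 * R + 3)
  have hS : ∀ n : ℕ, ∃ S : ℝ, ∀ a b : ℂ, ‖a‖ ≤ R → ‖b‖ ≤ R →
      ‖-(thetaSlope n b (1 - n - a)) / (n.factorial : ℂ)‖ ≤ S := by
    intro n
    have h2 : Differentiable ℂ fun p : ℂ × ℂ => thetaSlope n p.2 (1 - n - p.1) :=
      (differentiable_thetaSlope n).comp
        (show Differentiable ℂ fun p : ℂ × ℂ => (p.2, 1 - (n : ℂ) - p.1) by fun_prop)
    have h3 : Continuous fun p : ℂ × ℂ => -(thetaSlope n p.2 (1 - n - p.1)) / (n.factorial : ℂ) :=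
      Differentiable.continuous (𝕜 := ℂ) (by fun_prop)
    obtain ⟨S, hS⟩ := ((isCompact_closedBall (0 : ℂ) R).prod
      (isCompact_closedBall (0 : ℂ) R)).exists_bound_of_continuousOn h3.continuousOn
    exact ⟨S, fun a b ha hb => hS (a, b) ⟨by simpa using ha, by simpa using hb⟩⟩
  choose S hS using hS
  refine ⟨4 * K + ∑ n ∈ Finset.range M, (2 * K + |S n|), fun δ h0 hδ => ?_⟩
  have hd1 : δ < 1 := by linarith
  have hsum1 := (summable_decay_div h0 hd1).mul_left (4 * K)
  have hsum2 : HasSum (fun n => if n ∈ Finset.range M then (2 * K + |S n|) / δ else 0)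
      (∑ n ∈ Finset.range M, (2 * K + |S n|) / δ) := by
    rw [← Finset.sum_congr rfl fun n hn => if_pos hn]
    exact hasSum_sum_of_ne_finset_zero fun n hn => if_neg hn
  refine ⟨fun n => 4 * K * (decay δ n / ((n : ℝ) + 1)) +
    (if n ∈ Finset.range M then (2 * K + |S n|) / δ else 0), hsum1.add hsum2.summable, ?_, ?_⟩
  · rw [hsum1.tsum_add hsum2.summable, hsum2.tsum_eq, tsum_mul_left, add_div, Finset.sum_div]
    have := tsum_decay_div_le h0 hd1
    gcongr
    rw [div_eq_mul_one_div]
    gcongr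
  · intro a b hr n
    have hpos := decay_pos hd1 n
    have ha := norm_binCoeff_le hr.norm_left hδ.le hr.re_left n
    have hb := norm_binCoeff_le hr.norm_right hδ.le hr.re_right n
    have hab : ‖binCoeff n a + binCoeff n b‖ ≤ 2 * (K * decay δ n) :=
      (norm_add_le _ _).trans (by linarith)
    have hn0 : (0 : ℝ) < n + 1 := by positivity
    have hu1 : 0 ≤ 4 * K * (decay δ n / ((n : ℝ) + 1)) := by positivity
    beta_reduce
    by_cases hn : n ∈ Finset.range M
    · rw [if_pos hn]
      refine le_trans ?_ (le_add_of_nonneg_left hu1)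
      unfold coeff
      split_ifs with he
      · obtain ⟨k, rfl⟩ := he
        have hk := hr.le_norm k
        rw [norm_div]
        have h3 : (((k + k : ℕ) : ℂ)) = 2 * (k : ℂ) := by push_cast; ring
        have h4 := decay_le_one h0 hd1 (k + k)
        simp only [h3]
        gcongr
        refine hab.trans ?_
        have : K * decay δ (k + k) ≤ K := mul_le_of_le_one_right hK.le h4
        linarith [abs_nonneg (S (k + k))]
      · refine (hS n a b hr.norm_left hr.norm_right).trans ?_
        rw [le_div_iff₀ h0]
        have h1 : S n ≤ |S n| := le_abs_self _
        have h2 : |S n| * δ ≤ |S n| := mul_le_of_le_one_right (abs_nonneg _) hd1.le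
        have h3 : S n * δ ≤ |S n| * δ := by gcongr
        linarith
    · rw [if_neg hn, add_zero]
      have hMn : (M : ℝ) ≤ n := by exact_mod_cast not_lt.1 (fun h => hn (Finset.mem_range.2 h))
      have hlow : ((n : ℝ) + 1) / 2 ≤ ‖1 - a - b - n‖ := by
        have h1 : ‖(n : ℂ)‖ ≤ ‖1 - a - b - n‖ + ‖1 - a - b‖ := by
          rw [add_comm]
          calc ‖(n : ℂ)‖ = ‖(1 - a - b) - (1 - a - b - n)‖ := by congr 1; ring
            _ ≤ _ := norm_sub_le _ _
        have h2 : ‖1 - a - b‖ ≤ 1 + ‖a‖ + ‖b‖ :=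
          (norm_sub_le _ _).trans (by gcongr; exact (norm_sub_le _ _).trans (by simp))
        rw [Complex.norm_natCast] at h1
        linarith [hr.norm_left, hr.norm_right]
      have hm := mul_coeff (hr.mem h0) n
      have h5 : ‖1 - a - b - n‖ * ‖coeff n (a, b)‖ ≤ 2 * (K * decay δ n) := by
        rw [← norm_mul, hm]; exact hab
      have h6 : ((n : ℝ) + 1) / 2 * ‖coeff n (a, b)‖ ≤ 2 * (K * decay δ n) :=
        (mul_le_mul_of_nonneg_right hlow (norm_nonneg _)).trans h5
      rw [← mul_div_assoc, le_div_iff₀ hn0]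
      linarith

/-! ### The heat integral as a series -/

/-- The Gaussian factor `exp (-z² / (4t))` of the heat kernel. -/
noncomputable def gauss (t z : ℝ) : ℝ := Real.exp (-z ^ 2 / (4 * t))

lemma continuous_gauss (t : ℝ) : Continuous (gauss t) := by
  unfold gauss
  simp only [div_eq_mul_inv]
  fun_prop

lemma gauss_nonneg (t z : ℝ) : 0 ≤ gauss t z := (Real.exp_pos _).le

lemma gauss_le_one {t : ℝ} (ht : 0 < t) (z : ℝ) : gauss t z ≤ 1 := by
  refine Real.exp_le_one_iff.2 ?_
  rw [neg_div]
  have : 0 ≤ z ^ 2 / (4 * t) := by positivity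
  linarith

lemma norm_gauss_le_one {t : ℝ} (ht : 0 < t) (z : ℝ) : ‖(gauss t z : ℂ)‖ ≤ 1 := by
  rw [Complex.norm_real, Real.norm_of_nonneg (gauss_nonneg t z)]
  exact gauss_le_one ht z

/-- Lebesgue measure on the open unit interval. -/
noncomputable abbrev unitLebesgue : Measure ℝ := volume.restrict (Set.Ioo 0 1)

lemma intervalIntegral_eq_unitLebesgue (f : ℝ → ℂ) :
    ∫ x in (0 : ℝ)..1, f x = ∫ x, f x ∂unitLebesgue := by
  rw [intervalIntegral.integral_of_le zero_le_one, integral_Ioc_eq_integral_Ioo]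

lemma integrable_cpow_unitLebesgue {r : ℂ} (hr : -1 < r.re) :
    Integrable (fun x : ℝ => (x : ℂ) ^ r) unitLebesgue :=
  ((intervalIntegrable_iff_integrableOn_Ioo_of_le zero_le_one).1
    (intervalIntegral.intervalIntegrable_cpow' hr))

lemma integrable_one_sub_cpow_unitLebesgue {r : ℂ} (hr : -1 < r.re) :
    Integrable (fun x : ℝ => (1 - x : ℂ) ^ r) unitLebesgue := by
  refine (intervalIntegrable_iff_integrableOn_Ioo_of_le zero_le_one).1 ?_
  have h := (intervalIntegral.intervalIntegrable_cpow' (a := 0) (b := 1) hr).comp_sub_left 1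
  simpa using h.symm

/-- A double integral over the unit square, split along the diagonal. -/
lemma integral_unitSquare_split {F : ℝ → ℝ → ℂ}
    (hF : Integrable (Function.uncurry F) (unitLebesgue.prod unitLebesgue)) :
    ∫ y in (0 : ℝ)..1, ∫ x in (0 : ℝ)..1, F y x =
      (∫ y in (0 : ℝ)..1, ∫ x in (0 : ℝ)..y, F y x) +
        ∫ x in (0 : ℝ)..1, ∫ y in (0 : ℝ)..x, F y x := by
  have hT : MeasurableSet {p : ℝ × ℝ | p.2 ≤ p.1} := measurableSet_le measurable_snd measurable_fst
  simp only [intervalIntegral_eq_unitLebesgue]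
  have h0 : ∫ p, Function.uncurry F p ∂(unitLebesgue.prod unitLebesgue) =
      ∫ y, ∫ x, F y x ∂unitLebesgue ∂unitLebesgue := integral_prod _ hF
  rw [← h0, ← integral_add_compl hT hF, ← integral_indicator hT, ← integral_indicator hT.compl,
    integral_prod _ (hF.indicator hT), integral_prod_symm _ (hF.indicator hT.compl)]
  congr 1
  · refine setIntegral_congr_fun measurableSet_Ioo fun y hy => ?_
    have h1 : (fun x => Set.indicator {p : ℝ × ℝ | p.2 ≤ p.1} (Function.uncurry F) (y, x)) =
        (Set.Iic y).indicator (F y) := by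
      ext x; simp [Set.indicator_apply]
    have h2 : Set.Iic y ∩ Set.Ioo (0 : ℝ) 1 = Set.Ioc 0 y := by
      ext x; simp only [Set.mem_inter_iff, Set.mem_Iic, Set.mem_Ioo, Set.mem_Ioc]
      exact ⟨fun h => ⟨h.2.1, h.1⟩, fun h => ⟨h.2, h.1, h.2.trans_lt hy.2⟩⟩
    rw [h1, integral_indicator measurableSet_Iic, Measure.restrict_restrict measurableSet_Iic, h2,
      intervalIntegral.integral_of_le hy.1.le]
  · refine setIntegral_congr_fun measurableSet_Ioo fun x hx => ?_
    have h1 : (fun y => Set.indicator {p : ℝ × ℝ | p.2 ≤ p.1}ᶜ (Function.uncurry F) (y, x)) =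
        (Set.Iio x).indicator (fun y => F y x) := by
      ext y; simp [Set.indicator_apply]
    have h2 : Set.Iio x ∩ Set.Ioo (0 : ℝ) 1 = Set.Ioo 0 x := by
      ext y; simp only [Set.mem_inter_iff, Set.mem_Iio, Set.mem_Ioo]
      exact ⟨fun h => ⟨h.2.1, h.1⟩, fun h => ⟨h.2, h.1, h.2.trans hx.2⟩⟩
    rw [h1, integral_indicator measurableSet_Iio, Measure.restrict_restrict measurableSet_Iio, h2,
      intervalIntegral.integral_of_le hx.1.le, integral_Ioc_eq_integral_Ioo]

lemma integral_eq_mul_integral_one_sub (f : ℝ → ℂ) {y : ℝ} (hy : 0 < y) :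
    ∫ x in (0 : ℝ)..y, f x = y * ∫ u in (0 : ℝ)..1, f (y * (1 - u)) := by
  have h1 := intervalIntegral.integral_comp_sub_left (a := 0) (b := 1) (fun u => f (y * u)) 1
  have h2 := intervalIntegral.integral_comp_mul_left (a := 0) (b := 1) f hy.ne'
  simp only [sub_self, sub_zero] at h1
  rw [h1, h2, mul_zero, mul_one, Complex.real_smul, Complex.ofReal_inv, mul_inv_cancel_left₀]
  exact_mod_cast hy.ne'

/-- The contribution of the triangle `x < y` to the heat integral, in the coordinates
`(y, u)` with `x = y (1 - u)`; here `s = a + b`. -/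
noncomputable def triangleIntegral (t : ℝ) (s a : ℂ) : ℂ :=
  ∫ y in (0 : ℝ)..1, ∫ u in (0 : ℝ)..1,
    (y : ℂ) ^ (1 - s) * (1 - u : ℂ) ^ (-a) * (gauss t (y * u) : ℂ)

lemma integral_triangle (t : ℝ) (a b : ℂ) :
    ∫ y in (0 : ℝ)..1, ∫ x in (0 : ℝ)..y,
      (gauss t (x - y) : ℂ) * (x : ℂ) ^ (-a) * (y : ℂ) ^ (-b) = triangleIntegral t (a + b) a := by
  unfold triangleIntegral
  refine intervalIntegral.integral_congr_ae (Eventually.of_forall fun y hy => ?_)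
  rw [Set.uIoc_of_le zero_le_one] at hy
  have hy0 : (y : ℂ) ≠ 0 := by exact_mod_cast hy.1.ne'
  rw [integral_eq_mul_integral_one_sub _ hy.1, ← intervalIntegral.integral_const_mul]
  refine intervalIntegral.integral_congr fun u hu => ?_
  rw [Set.uIcc_of_le zero_le_one] at hu
  have h1 : gauss t (y * (1 - u) - y) = gauss t (y * u) := by
    unfold gauss; congr 2; ring
  have h2 : ((y * (1 - u) : ℝ) : ℂ) ^ (-a) = (y : ℂ) ^ (-a) * (1 - u : ℂ) ^ (-a) := by
    have := Complex.mul_cpow_ofReal_nonneg hy.1.le (sub_nonneg.2 hu.2) (-a)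
    push_cast at this ⊢
    exact this
  have h3 : (y : ℂ) ^ (1 - (a + b)) = y * (y : ℂ) ^ (-a) * (y : ℂ) ^ (-b) := by
    rw [show 1 - (a + b) = 1 + -a + -b by ring, Complex.cpow_add _ _ hy0,
      Complex.cpow_add _ _ hy0, Complex.cpow_one]
  simp only [h1, h2, h3]
  ring

lemma integrable_heat_integrand {a b : ℂ} (ha : a.re < 1) (hb : b.re < 1) {t : ℝ} (ht : 0 < t) :
    Integrable (Function.uncurry fun y x : ℝ =>
      (gauss t (x - y) : ℂ) * (x : ℂ) ^ (-a) * (y : ℂ) ^ (-b))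
      (unitLebesgue.prod unitLebesgue) := by
  have h := (integrable_cpow_unitLebesgue (r := -b) (by simpa using hb)).mul_prod
    (integrable_cpow_unitLebesgue (r := -a) (by simpa using ha))
  have hc : Continuous fun p : ℝ × ℝ => (gauss t (p.2 - p.1) : ℂ) :=
    Complex.continuous_ofReal.comp ((continuous_gauss t).comp (by fun_prop))
  refine (h.bdd_mul hc.aestronglyMeasurable
    (Eventually.of_forall fun p => norm_gauss_le_one ht _)).congr
    (Eventually.of_forall fun p => ?_)
  simp only [Function.uncurry]
  ring

/-- The two triangles contribute in the same way, with `a` and `b` exchanged. -/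
lemma heatContent_eq_triangleIntegral {a b : ℂ} (ha : a.re < 1) (hb : b.re < 1) {t : ℝ}
    (ht : 0 < t) :
    heatContent a b t = ((1 / Real.sqrt (4 * Real.pi * t) : ℝ) : ℂ) *
      (triangleIntegral t (a + b) a + triangleIntegral t (a + b) b) := by
  unfold heatContent
  congr 1
  have h := integral_unitSquare_split (integrable_heat_integrand ha hb ht)
  have h1 := integral_triangle t b a
  rw [add_comm b a] at h1
  rw [integral_triangle] at h
  rw [← h1]
  refine h.trans ?_
  congr 1
  refine intervalIntegral.integral_congr fun y _ => intervalIntegral.integral_congr fun x _ => ?_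
  have h2 : gauss t (x - y) = gauss t (y - x) := by unfold gauss; congr 2; ring
  simp only [h2]
  ring

/-- The moments `∬ y ^ (1 - s) u ^ n exp (-(yu)² / (4t))` over the unit square. -/
noncomputable def squareMoment (t : ℝ) (s : ℂ) (n : ℕ) : ℂ :=
  ∫ y in (0 : ℝ)..1, ∫ u in (0 : ℝ)..1,
    (y : ℂ) ^ (1 - s) * (u : ℂ) ^ n * (gauss t (y * u) : ℂ)

lemma integrable_prod_mul_gauss {f g : ℝ → ℂ} (hf : Integrable f unitLebesgue)
    (hg : Integrable g unitLebesgue) {t : ℝ} (ht : 0 < t) :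
    Integrable (fun p : ℝ × ℝ => f p.1 * g p.2 * (gauss t (p.1 * p.2) : ℂ))
      (unitLebesgue.prod unitLebesgue) := by
  have hc : Continuous fun p : ℝ × ℝ => (gauss t (p.1 * p.2) : ℂ) :=
    Complex.continuous_ofReal.comp ((continuous_gauss t).comp (by fun_prop))
  refine ((hf.mul_prod hg).bdd_mul hc.aestronglyMeasurable
    (Eventually.of_forall fun p => norm_gauss_le_one ht _)).congr
    (Eventually.of_forall fun p => ?_)
  ring

lemma integral_pow_unitLebesgue (n : ℕ) :
    ∫ u, ‖(u : ℂ) ^ n‖ ∂unitLebesgue = 1 / ((n : ℝ) + 1) := by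
  have h : ∫ u, ‖(u : ℂ) ^ n‖ ∂unitLebesgue = ∫ u in (0 : ℝ)..1, u ^ n := by
    rw [intervalIntegral.integral_of_le zero_le_one, integral_Ioc_eq_integral_Ioo]
    refine setIntegral_congr_fun measurableSet_Ioo fun u hu => ?_
    simp [abs_of_pos hu.1]
  rw [h, integral_pow]
  simp

/-- The binomial series integrates term by term, because `∑ |θ_n(a) / n!| / (n + 1)` converges for
`Re a < 1`. -/
lemma hasSum_triangleIntegral {a s : ℂ} (ha : a.re < 1) (hs : s.re < 2) {t : ℝ} (ht : 0 < t) :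
    HasSum (fun n => binCoeff n a * squareMoment t s n) (triangleIntegral t s a) := by
  have hy := integrable_cpow_unitLebesgue (r := 1 - s) (by simp; linarith)
  have hpow : ∀ n : ℕ, Integrable (fun u : ℝ => (u : ℂ) ^ n) unitLebesgue := fun n => by
    simpa using integrable_cpow_unitLebesgue (r := n)
      (by simp; linarith [(n.cast_nonneg : (0 : ℝ) ≤ n)])
  have hsub := integrable_one_sub_cpow_unitLebesgue (r := -a) (by simpa using ha)
  set F : ℕ → ℝ × ℝ → ℂ := fun n p =>
    binCoeff n a * ((p.1 : ℂ) ^ (1 - s) * (p.2 : ℂ) ^ n * (gauss t (p.1 * p.2) : ℂ))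
  have hF : ∀ n, Integrable (F n) (unitLebesgue.prod unitLebesgue) := fun n =>
    (integrable_prod_mul_gauss hy (hpow n) ht).const_mul _
  have hnorm : ∀ n, ∫ p, ‖F n p‖ ∂(unitLebesgue.prod unitLebesgue) ≤
      (∫ y, ‖(y : ℂ) ^ (1 - s)‖ ∂unitLebesgue) * (‖binCoeff n a‖ / ((n : ℝ) + 1)) := fun n => by
    calc ∫ p, ‖F n p‖ ∂(unitLebesgue.prod unitLebesgue)
        ≤ ∫ p : ℝ × ℝ, ‖binCoeff n a‖ * (‖(p.1 : ℂ) ^ (1 - s)‖ * ‖(p.2 : ℂ) ^ n‖)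
            ∂(unitLebesgue.prod unitLebesgue) := by
          refine integral_mono (hF n).norm ((hy.norm.mul_prod (hpow n).norm).const_mul _)
            fun p => ?_
          simp only [F, norm_mul]
          refine mul_le_mul_of_nonneg_left ?_ (norm_nonneg _)
          exact mul_le_of_le_one_right (by positivity) (norm_gauss_le_one ht _)
      _ = _ := by
          rw [integral_const_mul, integral_prod_mul (fun y : ℝ => ‖(y : ℂ) ^ (1 - s)‖)
            (fun u : ℝ => ‖(u : ℂ) ^ n‖), integral_pow_unitLebesgue]
          ring
  have hsum : Summable fun n => ∫ p, ‖F n p‖ ∂(unitLebesgue.prod unitLebesgue) :=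
    Summable.of_nonneg_of_le (fun n => integral_nonneg fun p => norm_nonneg _) hnorm
      ((summable_norm_binCoeff_div ha).mul_left _)
  have h := hasSum_integral_of_summable_integral_norm hF hsum
  have hterm : ∀ n, ∫ p, F n p ∂(unitLebesgue.prod unitLebesgue) =
      binCoeff n a * squareMoment t s n := fun n => by
    simp only [F]
    rw [integral_const_mul, integral_prod _ (integrable_prod_mul_gauss hy (hpow n) ht)]
    simp only [squareMoment, intervalIntegral_eq_unitLebesgue]
  have htot : ∫ p, ∑' n, F n p ∂(unitLebesgue.prod unitLebesgue) = triangleIntegral t s a := by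
    have h1 : ∫ p, ∑' n, F n p ∂(unitLebesgue.prod unitLebesgue) =
        ∫ p : ℝ × ℝ, (p.1 : ℂ) ^ (1 - s) * (1 - p.2 : ℂ) ^ (-a) * (gauss t (p.1 * p.2) : ℂ)
          ∂(unitLebesgue.prod unitLebesgue) := by
      rw [Measure.prod_restrict]
      refine setIntegral_congr_fun (measurableSet_Ioo.prod measurableSet_Ioo) fun p hp => ?_
      have hp2 : ‖(p.2 : ℂ)‖ < 1 := by
        rw [Complex.norm_real, Real.norm_of_nonneg hp.2.1.le]; exact hp.2.2
      have h2 := ((hasSum_binCoeff_mul_pow a hp2).mul_left ((p.1 : ℂ) ^ (1 - s))).mul_right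
        (gauss t (p.1 * p.2) : ℂ)
      rw [← h2.tsum_eq]
      refine tsum_congr fun n => ?_
      simp only [F]
      ring
    rw [h1, integral_prod _ (integrable_prod_mul_gauss hy hsub ht)]
    simp only [triangleIntegral, intervalIntegral_eq_unitLebesgue]
  simp only [hterm] at h
  rwa [htot] at h

/-- The fundamental theorem of calculus for `y ^ (1 - s - n) * ∫_0^y z ^ n exp (-z² / (4t)) dz`,
which vanishes at `0` because `Re s < 2`. -/
lemma mul_squareMoment {s : ℂ} (hs : s.re < 2) (t : ℝ) (n : ℕ) :
    (1 - s - n) * squareMoment t s n =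
      (∫ z in (0 : ℝ)..1, (z : ℂ) ^ n * (gauss t z : ℂ)) -
        ∫ z in (0 : ℝ)..1, (z : ℂ) ^ (1 - s) * (gauss t z : ℂ) := by
  have hg : Continuous fun z : ℝ => (gauss t z : ℂ) :=
    Complex.continuous_ofReal.comp (continuous_gauss t)
  have hG : Continuous fun z : ℝ => (z : ℂ) ^ n * (gauss t z : ℂ) := by fun_prop
  set M : ℝ → ℂ := fun y => ∫ u in (0 : ℝ)..1, (u : ℂ) ^ n * (gauss t (y * u) : ℂ) with hM
  have hMc : Continuous M := by
    refine intervalIntegral.continuous_parametric_intervalIntegral_of_continuous' ?_ 0 1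
    have h1 : Continuous fun p : ℝ × ℝ => (gauss t (p.1 * p.2) : ℂ) := hg.comp (by fun_prop)
    have h2 : Continuous fun p : ℝ × ℝ => (p.2 : ℂ) ^ n := by fun_prop
    exact h2.mul h1
  have hscale : ∀ y : ℝ, 0 < y →
      (y : ℂ) ^ (n + 1) * M y = ∫ z in (0 : ℝ)..y, (z : ℂ) ^ n * (gauss t z : ℂ) := by
    intro y hy
    have h2 := intervalIntegral.integral_comp_mul_left (a := 0) (b := 1)
      (fun z : ℝ => (z : ℂ) ^ n * (gauss t z : ℂ)) hy.ne'
    have hy0 : (y : ℂ) ≠ 0 := by exact_mod_cast hy.ne'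
    rw [mul_zero, mul_one, Complex.real_smul, Complex.ofReal_inv, eq_inv_mul_iff_mul_eq₀ hy0] at h2
    rw [← h2, pow_succ', mul_assoc, hM, ← intervalIntegral.integral_const_mul]
    congr 1
    refine intervalIntegral.integral_congr fun u _ => ?_
    simp only [Complex.ofReal_mul]
    ring
  have hftc := intervalIntegral.integral_eq_sub_of_hasDerivAt_of_le (a := 0) (b := 1)
    (f := fun y : ℝ => (y : ℂ) ^ (2 - s) * M y)
    (f' := fun y : ℝ => (1 - s - n) * ((y : ℂ) ^ (1 - s) * M y) +
      (y : ℂ) ^ (1 - s) * (gauss t y : ℂ)) zero_le_one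
    ((Complex.continuous_ofReal_cpow_const (by simp; linarith)).mul hMc).continuousOn ?_ ?_
  · have hne : (2 : ℂ) - s ≠ 0 := fun h => by
      have := congrArg Complex.re h
      simp at this
      linarith
    have hI := intervalIntegral.intervalIntegrable_cpow' (a := 0) (b := 1) (r := 1 - s)
      (by simp; linarith)
    rw [intervalIntegral.integral_add ((hI.mul_continuousOn hMc.continuousOn).const_mul _)
      (hI.mul_continuousOn hg.continuousOn), intervalIntegral.integral_const_mul] at hftc
    have hsq : squareMoment t s n = ∫ y in (0 : ℝ)..1, (y : ℂ) ^ (1 - s) * M y := by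
      unfold squareMoment
      refine intervalIntegral.integral_congr fun y _ => ?_
      simp only [hM, mul_assoc]
      rw [intervalIntegral.integral_const_mul]
    have hM1 : M 1 = ∫ z in (0 : ℝ)..1, (z : ℂ) ^ n * (gauss t z : ℂ) := by simp [hM]
    rw [← hM1, hsq]
    simp only [Complex.ofReal_one, Complex.one_cpow, Complex.ofReal_zero, Complex.zero_cpow hne,
      zero_mul, one_mul, sub_zero] at hftc
    rw [← hftc]
    ring
  · rintro y ⟨hy, -⟩
    have hy0 : (y : ℂ) ≠ 0 := by exact_mod_cast hy.ne'
    have hI : HasDerivAt (fun y : ℝ => ∫ z in (0 : ℝ)..y, (z : ℂ) ^ n * (gauss t z : ℂ))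
        ((y : ℂ) ^ n * (gauss t y : ℂ)) y :=
      intervalIntegral.integral_hasDerivAt_right (hG.intervalIntegrable _ _)
        (hG.stronglyMeasurableAtFilter _ _) hG.continuousAt
    by_cases hexp : (1 - s - n : ℂ) = 0
    · have hs1 : 1 - s = (n : ℂ) := by linear_combination hexp
      have hs2 : 2 - s = ((n + 1 : ℕ) : ℂ) := by push_cast; linear_combination hexp
      rw [hexp, zero_mul, zero_add, hs1, Complex.cpow_natCast]
      refine hI.congr_of_eventuallyEq ?_
      filter_upwards [lt_mem_nhds hy] with z hz
      rw [hs2, Complex.cpow_natCast, hscale z hz]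
    · have hP := (hasDerivAt_ofReal_cpow_const hy.ne' hexp).mul hI
      have hsplit : ∀ z : ℝ, 0 < z →
          (z : ℂ) ^ (2 - s) * M z = (z : ℂ) ^ (1 - s - n : ℂ) *
            ∫ w in (0 : ℝ)..z, (w : ℂ) ^ n * (gauss t w : ℂ) := fun z hz => by
        have hz0 : (z : ℂ) ≠ 0 := by exact_mod_cast hz.ne'
        rw [← hscale z hz, ← mul_assoc, ← Complex.cpow_natCast, ← Complex.cpow_add _ _ hz0]
        congr 2
        push_cast
        ring
      refine (hP.congr_of_eventuallyEq ?_).congr_deriv ?_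
      · filter_upwards [lt_mem_nhds hy] with z hz
        exact hsplit z hz
      · rw [← hscale y hy, ← mul_assoc, mul_assoc _ _ ((y : ℂ) ^ (n + 1)),
          ← mul_assoc _ _ (gauss t y : ℂ),
          ← Complex.cpow_natCast, ← Complex.cpow_natCast, ← Complex.cpow_add _ _ hy0,
          ← Complex.cpow_add _ _ hy0]
        push_cast
        rw [show (1 - s - n - 1 + (n + 1) : ℂ) = 1 - s by ring,
          show (1 - s - n + n : ℂ) = 1 - s by ring]
        ring
  · have hI := intervalIntegral.intervalIntegrable_cpow' (a := 0) (b := 1) (r := 1 - s)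
      (by simp; linarith)
    exact ((hI.mul_continuousOn hMc.continuousOn).const_mul _).add
      (hI.mul_continuousOn hg.continuousOn)

/-! ### Gaussian moments and the remainder -/

/-- The Gaussian moment `∫_0^1 z ^ q exp (-z² / (4t)) dz`. -/
noncomputable def truncMoment (t : ℝ) (q : ℂ) : ℂ :=
  ∫ z in (0 : ℝ)..1, (z : ℂ) ^ q * (gauss t z : ℂ)

/-- The Gaussian moment `∫_0^∞ z ^ q exp (-z² / (4t)) dz`. -/
noncomputable def fullMoment (t : ℝ) (q : ℂ) : ℂ :=
  ∫ z in Set.Ioi (0 : ℝ), (z : ℂ) ^ q * (gauss t z : ℂ)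

/-- The constant in the full moment: the heat kernel normalisation turns `∫_0^∞` of
`z ^ q exp (-z² / (4t))` into `momentConst q * t ^ (q / 2)`. -/
noncomputable def momentConst (q : ℂ) : ℂ :=
  (2 : ℂ) ^ (q - 1) * Complex.Gamma ((1 + q) / 2) / (Real.sqrt Real.pi : ℂ)

lemma gauss_eq (t z : ℝ) : gauss t z = Real.exp (-(1 / (4 * t)) * z ^ 2) := by
  unfold gauss; congr 1; ring

lemma norm_cpow_mul_gauss (t : ℝ) (q : ℂ) {z : ℝ} (hz : 0 < z) :
    ‖(z : ℂ) ^ q * (gauss t z : ℂ)‖ = z ^ q.re * gauss t z := by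
  rw [norm_mul, Complex.norm_cpow_eq_rpow_re_of_pos hz, Complex.norm_real,
    Real.norm_of_nonneg (gauss_nonneg t z)]

lemma integrableOn_rpow_mul_gauss {t : ℝ} (ht : 0 < t) {q : ℝ} (hq : -1 < q) :
    IntegrableOn (fun z : ℝ => z ^ q * gauss t z) (Set.Ioi 0) := by
  simp only [gauss_eq]
  exact integrableOn_rpow_mul_exp_neg_mul_sq (by positivity) hq

lemma integrableOn_cpow_mul_gauss {t : ℝ} (ht : 0 < t) {q : ℂ} (hq : -1 < q.re) :
    IntegrableOn (fun z : ℝ => (z : ℂ) ^ q * (gauss t z : ℂ)) (Set.Ioi 0) := by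
  have hmeas : AEStronglyMeasurable (fun z : ℝ => (z : ℂ) ^ q * (gauss t z : ℂ))
      (volume.restrict (Set.Ioi 0)) := by
    refine ContinuousOn.aestronglyMeasurable (ContinuousOn.mul (fun z hz => ?_) ?_)
      measurableSet_Ioi
    · exact (Complex.continuousAt_ofReal_cpow_const _ _
        (Or.inr (ne_of_gt hz))).continuousWithinAt
    · exact (Complex.continuous_ofReal.comp (continuous_gauss t)).continuousOn
  refine (integrable_norm_iff hmeas).1 ?_
  exact (integrableOn_rpow_mul_gauss ht hq).congr_fun
    (fun z hz => (norm_cpow_mul_gauss t q hz).symm) measurableSet_Ioi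

/-- The substitution `w = z²` reduces the full moment to Euler's integral. -/
lemma fullMoment_eq {t : ℝ} (ht : 0 < t) {q : ℂ} (hq : -1 < q.re) :
    fullMoment t q = 1 / 2 * ((4 * t : ℝ) : ℂ) ^ ((q + 1) / 2) * Complex.Gamma ((q + 1) / 2) := by
  have h1 := integral_comp_rpow_Ioi (fun w : ℝ => (w : ℂ) ^ ((q + 1) / 2 - 1) *
    Complex.exp (-(((1 / (4 * t) : ℝ) : ℂ) * w))) (two_ne_zero : (2 : ℝ) ≠ 0)
  rw [Complex.integral_cpow_mul_exp_neg_mul_Ioi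
    (by rw [show (q + 1) / 2 = ((1 / 2 : ℝ) : ℂ) * (q + 1) by push_cast; ring,
      Complex.re_ofReal_mul]; simp; linarith) (by positivity)] at h1
  have h2 : ∫ z in Set.Ioi (0 : ℝ), (|(2 : ℝ)| * z ^ ((2 : ℝ) - 1)) •
      (((z ^ (2 : ℝ) : ℝ) : ℂ) ^ ((q + 1) / 2 - 1) *
        Complex.exp (-(((1 / (4 * t) : ℝ) : ℂ) * ((z ^ (2 : ℝ) : ℝ) : ℂ)))) =
      2 * fullMoment t q := by
    rw [fullMoment, ← integral_const_mul]
    refine setIntegral_congr_fun measurableSet_Ioi fun z hz => ?_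
    have hz0 : (z : ℂ) ≠ 0 := by exact_mod_cast (ne_of_gt hz)
    have e1 : ((z ^ (2 : ℝ) : ℝ) : ℂ) ^ ((q + 1) / 2 - 1) = (z : ℂ) ^ (q - 1) := by
      rw [Complex.ofReal_cpow (le_of_lt hz), ← Complex.ofReal_cpow (le_of_lt hz),
        Real.rpow_two, pow_two, Complex.ofReal_mul,
        Complex.mul_cpow_ofReal_nonneg (le_of_lt hz) (le_of_lt hz), ← Complex.cpow_add _ _ hz0]
      congr 1
      ring
    have e2 : Complex.exp (-(((1 / (4 * t) : ℝ) : ℂ) * ((z ^ (2 : ℝ) : ℝ) : ℂ))) =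
        (gauss t z : ℂ) := by
      rw [gauss_eq, Real.rpow_two]
      push_cast
      congr 1
      ring
    have e3 : (z : ℂ) ^ q = z * (z : ℂ) ^ (q - 1) := by
      rw [Complex.cpow_sub _ _ hz0, Complex.cpow_one]
      field_simp
    rw [e1, e2, e3, Complex.real_smul, abs_two, show (2 : ℝ) - 1 = 1 by norm_num, Real.rpow_one]
    push_cast
    ring
  rw [h2] at h1
  have h3 : (1 / ((1 / (4 * t) : ℝ) : ℂ)) = ((4 * t : ℝ) : ℂ) := by push_cast; simp
  rw [h3] at h1
  linear_combination (1 / 2 : ℂ) * h1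

lemma heatNorm_mul_fullMoment {t : ℝ} (ht : 0 < t) {q : ℂ} (hq : -1 < q.re) :
    ((1 / Real.sqrt (4 * Real.pi * t) : ℝ) : ℂ) * fullMoment t q =
      momentConst q * (t : ℂ) ^ (q / 2) := by
  have ht0 : (t : ℂ) ≠ 0 := by exact_mod_cast ht.ne'
  have hpi : (Real.sqrt Real.pi : ℂ) ≠ 0 := by
    exact_mod_cast (Real.sqrt_pos.2 Real.pi_pos).ne'
  have hst : (Real.sqrt t : ℂ) ≠ 0 := by exact_mod_cast (Real.sqrt_pos.2 ht).ne'
  have h1 : Real.sqrt (4 * Real.pi * t) = 2 * Real.sqrt Real.pi * Real.sqrt t := by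
    rw [Real.sqrt_mul (by positivity), Real.sqrt_mul (by positivity),
      show (4 : ℝ) = 2 ^ 2 by norm_num, Real.sqrt_sq (by norm_num)]
  have h2 : ((4 * t : ℝ) : ℂ) ^ ((q + 1) / 2) =
      4 * (2 : ℂ) ^ (q - 1) * ((t : ℂ) ^ (q / 2) * (Real.sqrt t : ℂ)) := by
    have e1 : ((4 * t : ℝ) : ℂ) = ((2 : ℝ) : ℂ) * (((2 : ℝ) : ℂ) * (t : ℂ)) := by
      push_cast; ring
    have e2 : (Real.sqrt t : ℂ) = (t : ℂ) ^ (1 / 2 : ℂ) := by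
      rw [Real.sqrt_eq_rpow, Complex.ofReal_cpow ht.le]
      push_cast; rfl
    have e3 : ((2 : ℂ)) ^ ((q + 1) / 2) * (2 : ℂ) ^ ((q + 1) / 2) = 4 * (2 : ℂ) ^ (q - 1) := by
      rw [← Complex.cpow_add _ _ two_ne_zero,
        show (q + 1) / 2 + (q + 1) / 2 = (q - 1) + 2 by ring,
        Complex.cpow_add _ _ two_ne_zero, Complex.cpow_ofNat]
      ring
    rw [e1, ← Complex.ofReal_mul 2 t, Complex.mul_cpow_ofReal_nonneg (by norm_num) (by positivity),
      Complex.ofReal_mul, Complex.mul_cpow_ofReal_nonneg (by norm_num) ht.le, e2,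
      ← Complex.cpow_add _ _ ht0, ← e3, show q / 2 + 1 / 2 = (q + 1) / 2 by ring]
    push_cast
    ring
  rw [fullMoment_eq ht hq, h1, h2, momentConst, add_comm q 1]
  push_cast
  field_simp
  ring

lemma truncMoment_eq_setIntegral (t : ℝ) (q : ℂ) :
    truncMoment t q = ∫ z in Set.Ioc (0 : ℝ) 1, (z : ℂ) ^ q * (gauss t z : ℂ) :=
  intervalIntegral.integral_of_le zero_le_one

/-- The real number `∫_0^∞ z ^ m exp (-z² / (4t)) dz`, to which all errors are compared. -/
noncomputable def errorMoment (t : ℝ) (m : ℕ) : ℝ :=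
  ∫ z in Set.Ioi (0 : ℝ), z ^ (m : ℝ) * gauss t z

lemma ofReal_errorMoment (t : ℝ) (m : ℕ) : (errorMoment t m : ℂ) = fullMoment t m := by
  rw [errorMoment, fullMoment, ← integral_complex_ofReal]
  refine setIntegral_congr_fun measurableSet_Ioi fun z hz => ?_
  rw [Complex.ofReal_mul, Complex.ofReal_cpow (le_of_lt hz), Complex.ofReal_natCast]

lemma setIntegral_le_errorMoment {t : ℝ} (ht : 0 < t) (m : ℕ) {A : Set ℝ}
    (hA : A ⊆ Set.Ioi 0) :
    ∫ z in A, z ^ (m : ℝ) * gauss t z ≤ errorMoment t m := by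
  refine setIntegral_mono_set (integrableOn_rpow_mul_gauss ht
    (by linarith [(m.cast_nonneg : (0 : ℝ) ≤ m)])) ?_ hA.eventuallyLE
  filter_upwards [ae_restrict_mem measurableSet_Ioi] with z hz
  exact mul_nonneg (Real.rpow_nonneg (le_of_lt hz) _) (gauss_nonneg t z)

/-- On `z > 1` the smaller power is dominated by the larger one. -/
lemma norm_fullMoment_sub_truncMoment_le {t : ℝ} (ht : 0 < t) {q : ℂ} (hq : -1 < q.re) {m : ℕ}
    (hm : q.re ≤ m) : ‖fullMoment t q - truncMoment t q‖ ≤ errorMoment t m := by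
  have hI := integrableOn_cpow_mul_gauss ht hq
  have hI1 := integrableOn_rpow_mul_gauss ht (q := m) (by linarith)
  have hsub : Set.Ioi (1 : ℝ) ⊆ Set.Ioi 0 := Set.Ioi_subset_Ioi zero_le_one
  have h1 : fullMoment t q - truncMoment t q =
      ∫ z in Set.Ioi (1 : ℝ), (z : ℂ) ^ q * (gauss t z : ℂ) := by
    rw [fullMoment, truncMoment_eq_setIntegral, ← Set.Ioc_union_Ioi_eq_Ioi zero_le_one,
      setIntegral_union (Set.Ioc_disjoint_Ioi le_rfl) measurableSet_Ioi
        (hI.mono_set Set.Ioc_subset_Ioi_self) (hI.mono_set hsub)]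
    ring
  rw [h1]
  refine (norm_integral_le_integral_norm _).trans
    (le_trans ?_ (setIntegral_le_errorMoment ht m hsub))
  refine setIntegral_mono_on (hI.mono_set hsub).norm (hI1.mono_set hsub) measurableSet_Ioi
    fun z hz => ?_
  rw [norm_cpow_mul_gauss t q (hsub hz)]
  exact mul_le_mul_of_nonneg_right (Real.rpow_le_rpow_of_exponent_le (le_of_lt hz) hm)
    (gauss_nonneg t z)

/-- On `0 < z < 1` the larger power is dominated by the smaller one. -/
lemma norm_truncMoment_le {t : ℝ} (ht : 0 < t) {m n : ℕ} (h : m ≤ n) :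
    ‖truncMoment t n‖ ≤ errorMoment t m := by
  have hI := integrableOn_cpow_mul_gauss ht (q := n)
    (by simp; linarith [(n.cast_nonneg : (0 : ℝ) ≤ n)])
  have hI1 := integrableOn_rpow_mul_gauss ht (q := m)
    (by linarith [(m.cast_nonneg : (0 : ℝ) ≤ m)])
  have hsub : Set.Ioc (0 : ℝ) 1 ⊆ Set.Ioi 0 := Set.Ioc_subset_Ioi_self
  rw [truncMoment_eq_setIntegral]
  refine (norm_integral_le_integral_norm _).trans
    (le_trans ?_ (setIntegral_le_errorMoment ht m hsub))
  refine setIntegral_mono_on (hI.mono_set hsub).norm (hI1.mono_set hsub) measurableSet_Ioc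
    fun z hz => ?_
  rw [norm_cpow_mul_gauss t _ hz.1, Complex.natCast_re]
  exact mul_le_mul_of_nonneg_right
    (Real.rpow_le_rpow_of_exponent_ge hz.1 hz.2 (by exact_mod_cast h)) (gauss_nonneg t z)

lemma heatNorm_mul_errorMoment {t : ℝ} (ht : 0 < t) (m : ℕ) :
    1 / Real.sqrt (4 * Real.pi * t) * errorMoment t m =
      ‖momentConst m‖ * t ^ ((m : ℝ) / 2) := by
  have h1 := heatNorm_mul_fullMoment ht (q := m)
    (by simp; linarith [(m.cast_nonneg : (0 : ℝ) ≤ m)])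
  rw [← ofReal_errorMoment, ← Complex.ofReal_mul] at h1
  have h2 := congrArg norm h1
  have h3 : 0 ≤ errorMoment t m :=
    setIntegral_nonneg measurableSet_Ioi fun z hz =>
      mul_nonneg (Real.rpow_nonneg (le_of_lt hz) _) (gauss_nonneg t z)
  rw [Complex.norm_real, Real.norm_of_nonneg (by positivity), norm_mul,
    Complex.norm_cpow_eq_rpow_re_of_pos ht] at h2
  rw [h2]
  congr 2
  rw [show (m : ℂ) / 2 = ((m / 2 : ℝ) : ℂ) by push_cast; rfl, Complex.ofReal_re]

/-- The exact series for the heat content: in terms of the density of `|x - y| = z`, it says that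
this density is `∑ coeff n * (z ^ n - z ^ (1 - a - b))` on `0 < z < 1`. -/
lemma hasSum_coeff_mul_truncMoment {a b : ℂ} (h : (a, b) ∈ paramDomain) {t : ℝ} (ht : 0 < t) :
    HasSum (fun n : ℕ => coeff n (a, b) * (truncMoment t n - truncMoment t (1 - a - b)))
      (triangleIntegral t (a + b) a + triangleIntegral t (a + b) b) := by
  obtain ⟨ha, hb, -⟩ := id h
  simp only at ha hb
  have hs : (a + b).re < 2 := by rw [Complex.add_re]; linarith
  refine ((hasSum_triangleIntegral ha hs ht).add (hasSum_triangleIntegral hb hs ht)).congr_fun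
    fun n => ?_
  have h1 := mul_squareMoment hs t n
  have h2 : truncMoment t n = ∫ z in (0 : ℝ)..1, (z : ℂ) ^ n * (gauss t z : ℂ) := by
    simp only [truncMoment, Complex.cpow_natCast]
  rw [← h2, ← sub_sub] at h1
  rw [← add_mul, ← mul_coeff h n, truncMoment, truncMoment]
  unfold truncMoment at h1
  rw [← h1]
  ring

/-- Completing the truncated moments to full ones, for the first `N + 1` powers and for
`z ^ (1 - a - b)`, and dropping the later powers, each costs at most one error moment. -/
lemma norm_heatContent_sub_le {a b : ℂ} (h : (a, b) ∈ paramDomain) {N : ℕ}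
    (hN : -(a + b).re ≤ N) (hsum : Summable fun n => ‖coeff n (a, b)‖) {t : ℝ} (ht : 0 < t) :
    ‖heatContent a b t - (-(∑' n, coeff n (a, b)) * momentConst (1 - a - b) *
        (t : ℂ) ^ ((1 - a - b) / 2) +
      ∑ n ∈ Finset.range (N + 1), coeff n (a, b) * momentConst n * (t : ℂ) ^ ((n : ℂ) / 2))‖ ≤
      2 * (∑' n, ‖coeff n (a, b)‖) * (‖momentConst (N + 1 : ℕ)‖ * t ^ (((N : ℝ) + 1) / 2)) := by
  obtain ⟨ha, hb, -⟩ := id h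
  simp only at ha hb
  have hq : -1 < (1 - a - b).re := by simp; linarith
  have hqN : (1 - a - b).re ≤ (N + 1 : ℕ) := by
    rw [Complex.add_re] at hN
    simp
    linarith
  set K := 1 / Real.sqrt (4 * Real.pi * t)
  have hK0 : 0 ≤ K := by positivity
  have hT := hasSum_coeff_mul_truncMoment h ht
  set T := triangleIntegral t (a + b) a + triangleIntegral t (a + b) b
  have hS := hsum.of_norm.hasSum.mul_right (fullMoment t (1 - a - b))
  have hZ : HasSum (fun n : ℕ => if n ∈ Finset.range (N + 1) then
      coeff n (a, b) * fullMoment t n else 0)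
      (∑ n ∈ Finset.range (N + 1), coeff n (a, b) * fullMoment t n) := by
    rw [← Finset.sum_congr rfl fun n hn => if_pos hn]
    exact hasSum_sum_of_ne_finset_zero fun n hn => if_neg hn
  have hall := (hT.add hS).sub hZ
  have hbound := tsum_of_norm_bounded (hsum.hasSum.mul_right (2 * errorMoment t (N + 1)))
    (f := fun n : ℕ => coeff n (a, b) * (truncMoment t n - truncMoment t (1 - a - b)) +
      coeff n (a, b) * fullMoment t (1 - a - b) - (if n ∈ Finset.range (N + 1) then
      coeff n (a, b) * fullMoment t n else 0)) fun n => by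
    have hB := norm_fullMoment_sub_truncMoment_le ht hq hqN
    have hA : ‖truncMoment t n - (if n ∈ Finset.range (N + 1) then fullMoment t n else 0)‖ ≤
        errorMoment t (N + 1) := by
      split_ifs with hn
      · rw [norm_sub_rev]
        refine norm_fullMoment_sub_truncMoment_le ht
          (by simp; linarith [(n.cast_nonneg : (0 : ℝ) ≤ n)]) ?_
        rw [Complex.natCast_re]
        exact_mod_cast (Finset.mem_range.1 hn).le
      · rw [sub_zero]
        exact norm_truncMoment_le ht (not_lt.1 fun hlt => hn (Finset.mem_range.2 hlt))
    calc _ = ‖coeff n (a, b) *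
          ((truncMoment t n - (if n ∈ Finset.range (N + 1) then fullMoment t n else 0)) +
            (fullMoment t (1 - a - b) - truncMoment t (1 - a - b)))‖ := by
          congr 1
          split_ifs <;> ring
      _ ≤ _ := by
          rw [norm_mul, two_mul]
          gcongr
          exact (norm_add_le _ _).trans (add_le_add hA hB)
  rw [hall.tsum_eq] at hbound
  have hmain : heatContent a b t - (-(∑' n, coeff n (a, b)) * momentConst (1 - a - b) *
        (t : ℂ) ^ ((1 - a - b) / 2) +
      ∑ n ∈ Finset.range (N + 1), coeff n (a, b) * momentConst n * (t : ℂ) ^ ((n : ℂ) / 2)) =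
      (K : ℂ) * (T + (∑' n, coeff n (a, b)) * fullMoment t (1 - a - b) -
        ∑ n ∈ Finset.range (N + 1), coeff n (a, b) * fullMoment t n) := by
    have e1 := heatNorm_mul_fullMoment ht hq
    have e2 : ∀ n : ℕ, coeff n (a, b) * momentConst n * (t : ℂ) ^ ((n : ℂ) / 2) =
        K * (coeff n (a, b) * fullMoment t n) := fun n => by
      have := heatNorm_mul_fullMoment ht (q := n)
        (by simp; linarith [(n.cast_nonneg : (0 : ℝ) ≤ n)])
      rw [mul_assoc, ← this]
      ring
    simp only [e2]
    rw [heatContent_eq_triangleIntegral ha hb ht, ← Finset.mul_sum]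
    linear_combination (∑' n, coeff n (a, b)) * (-e1)
  rw [hmain, norm_mul, Complex.norm_real, Real.norm_of_nonneg hK0]
  have hKJ := heatNorm_mul_errorMoment ht (N + 1)
  rw [Nat.cast_add_one (R := ℝ)] at hKJ
  rw [← hKJ]
  calc _ ≤ K * ((∑' n, ‖coeff n (a, b)‖) * (2 * errorMoment t (N + 1))) := by gcongr
    _ = _ := by ring

/-! ### The sum of the coefficients and the function `c` -/

lemma integral_cpow_mul_pow_unitLebesgue {w : ℂ} (hw : 0 < w.re) (n : ℕ) :
    ∫ x : ℝ, (x : ℂ) ^ (w - 1) * (x : ℂ) ^ n ∂unitLebesgue = 1 / (n + w) := by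
  have hne : w - 1 + n + 1 ≠ 0 := fun h => by
    have := congrArg Complex.re h
    simp at this
    linarith [(n.cast_nonneg : (0 : ℝ) ≤ n)]
  have h1 : ∫ x : ℝ, (x : ℂ) ^ (w - 1) * (x : ℂ) ^ n ∂unitLebesgue =
      ∫ x in (0 : ℝ)..1, (x : ℂ) ^ (w - 1 + n) := by
    rw [intervalIntegral_eq_unitLebesgue]
    refine setIntegral_congr_fun measurableSet_Ioo fun x hx => ?_
    have hx0 : (x : ℂ) ≠ 0 := by exact_mod_cast hx.1.ne'
    simp only [Complex.cpow_add _ _ hx0, Complex.cpow_natCast]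
  rw [h1, integral_cpow (Or.inl (by simp; linarith [(n.cast_nonneg : (0 : ℝ) ≤ n)]))]
  simp only [Complex.ofReal_one, Complex.one_cpow, Complex.ofReal_zero, Complex.zero_cpow hne,
    sub_zero]
  congr 1
  ring

lemma integral_norm_cpow_mul_pow_unitLebesgue {w : ℂ} (hw : 0 < w.re) (n : ℕ) :
    ∫ x : ℝ, ‖(x : ℂ) ^ (w - 1) * (x : ℂ) ^ n‖ ∂unitLebesgue = 1 / (n + w.re) := by
  have h : ((∫ x : ℝ, ‖(x : ℂ) ^ (w - 1) * (x : ℂ) ^ n‖ ∂unitLebesgue : ℝ) : ℂ) =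
      ((1 / (n + w.re) : ℝ) : ℂ) := by
    rw [← integral_complex_ofReal]
    push_cast
    rw [← integral_cpow_mul_pow_unitLebesgue (w := (w.re : ℂ)) (by simpa using hw) n]
    refine setIntegral_congr_fun measurableSet_Ioo fun x hx => ?_
    rw [norm_mul, Complex.norm_cpow_eq_rpow_re_of_pos hx.1, norm_pow, Complex.norm_real,
      Real.norm_of_nonneg hx.1.le]
    push_cast
    rw [Complex.ofReal_cpow hx.1.le]
    simp
  exact_mod_cast h

/-- For `Re w > 0` this is the beta integral `∫_0^1 x ^ (w - 1) (1 - x) ^ (-b) dx`, with the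
binomial series integrated term by term. -/
lemma hasSum_binCoeff_div_of_re_pos {b w : ℂ} (hb : b.re < 1) (hw : 0 < w.re) :
    HasSum (fun n : ℕ => binCoeff n b / (n + w))
      (Complex.Gamma w * Complex.Gamma (1 - b) / Complex.Gamma (w + 1 - b)) := by
  have hint : ∀ n : ℕ, Integrable (fun x : ℝ => (x : ℂ) ^ (w - 1) * (x : ℂ) ^ n) unitLebesgue :=
    fun n => ((integrable_cpow_unitLebesgue (r := w - 1 + n)
      (by simp; linarith [(n.cast_nonneg : (0 : ℝ) ≤ n)])).congr (by
        filter_upwards [ae_restrict_mem measurableSet_Ioo] with x hx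
        have hx0 : (x : ℂ) ≠ 0 := by exact_mod_cast hx.1.ne'
        rw [Complex.cpow_add _ _ hx0, Complex.cpow_natCast]))
  have hsum : Summable fun n : ℕ =>
      ∫ x : ℝ, ‖binCoeff n b * ((x : ℂ) ^ (w - 1) * (x : ℂ) ^ n)‖ ∂unitLebesgue := by
    refine Summable.of_nonneg_of_le (fun n => integral_nonneg fun x => norm_nonneg _) (fun n => ?_)
      ((summable_norm_binCoeff_div hb).mul_left (1 + 1 / w.re))
    simp only [norm_mul (binCoeff n b)]
    rw [integral_const_mul, integral_norm_cpow_mul_pow_unitLebesgue hw, mul_one_div, mul_div_assoc',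
      div_le_div_iff₀ (by positivity) (by positivity)]
    have h1 : ((n : ℝ) + 1) ≤ (1 + 1 / w.re) * (n + w.re) := by
      have : (1 + 1 / w.re) * (n + w.re) = n + 1 + (w.re + n / w.re) := by field_simp; ring
      rw [this]
      have : 0 ≤ w.re + n / w.re := by positivity
      linarith
    calc ‖binCoeff n b‖ * ((n : ℝ) + 1) ≤ ‖binCoeff n b‖ * ((1 + 1 / w.re) * (n + w.re)) := by
          gcongr
      _ = _ := by ring
  have h := hasSum_integral_of_summable_integral_norm (fun n => (hint n).const_mul _) hsum
  have hval : ∫ x : ℝ, ∑' n : ℕ, binCoeff n b * ((x : ℂ) ^ (w - 1) * (x : ℂ) ^ n) ∂unitLebesgue =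
      Complex.betaIntegral w (1 - b) := by
    rw [Complex.betaIntegral, intervalIntegral_eq_unitLebesgue]
    refine setIntegral_congr_fun measurableSet_Ioo fun x hx => ?_
    have hx1 : ‖(x : ℂ)‖ < 1 := by
      rw [Complex.norm_real, Real.norm_of_nonneg hx.1.le]; exact hx.2
    have h2 := (hasSum_binCoeff_mul_pow b hx1).mul_left ((x : ℂ) ^ (w - 1))
    rw [show (1 : ℂ) - b - 1 = -b by ring, ← h2.tsum_eq]
    exact tsum_congr fun n => by ring
  have hG := Complex.Gamma_mul_Gamma_eq_betaIntegral hw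
    (show 0 < (1 - b).re by simp; linarith)
  have hG0 : Complex.Gamma (w + (1 - b)) ≠ 0 :=
    Complex.Gamma_ne_zero_of_re_pos (by simp; linarith)
  rw [hval] at h
  rw [show w + 1 - b = w + (1 - b) by ring, hG, mul_div_cancel_left₀ _ hG0]
  refine h.congr_fun fun n => ?_
  rw [integral_const_mul, integral_cpow_mul_pow_unitLebesgue hw, mul_one_div]

lemma summable_binCoeff_div {b : ℂ} (hb : b.re < 1) (w : ℂ) :
    Summable fun n : ℕ => binCoeff n b / (n + w) := by
  obtain ⟨M, hM⟩ := exists_nat_ge (2 * ‖w‖ + 1)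
  refine Summable.of_norm_bounded_eventually_nat
    ((summable_norm_binCoeff_div hb).mul_left 2) ?_
  filter_upwards [eventually_ge_atTop M] with n hn
  have hn' : 2 * ‖w‖ + 1 ≤ n := hM.trans (by exact_mod_cast hn)
  have h1 : (n : ℝ) ≤ ‖(n : ℂ) + w‖ + ‖w‖ := by
    calc (n : ℝ) = ‖((n : ℂ) + w) - w‖ := by simp
      _ ≤ _ := norm_sub_le _ _
  have h2 : ((n : ℝ) + 1) / 2 ≤ ‖(n : ℂ) + w‖ := by linarith
  have h3 : (0 : ℝ) < n + 1 := by positivity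
  rw [norm_div]
  calc ‖binCoeff n b‖ / ‖(n : ℂ) + w‖ ≤ ‖binCoeff n b‖ / (((n : ℝ) + 1) / 2) := by gcongr
    _ = _ := by field_simp

/-- The contiguity relation of the beta function, by telescoping
`n p_n / (n + w)`, where `p_n` is the binomial coefficient. -/
lemma mul_tsum_binCoeff_div {b : ℂ} (hb : b.re < 1) {w : ℂ} (hw : ∀ k : ℕ, w ≠ -k) :
    w * ∑' n : ℕ, binCoeff n b / (n + w) =
      (w + 1 - b) * ∑' n : ℕ, binCoeff n b / (n + (w + 1)) := by
  have hs1 := summable_binCoeff_div hb w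
  have hs2 := summable_binCoeff_div hb (w + 1)
  have hne : ∀ n : ℕ, (n : ℂ) + w ≠ 0 := fun n h => hw n (by linear_combination h)
  set T : ℕ → ℂ := fun n => n * binCoeff n b / (n + w) with hT
  have hterm : ∀ n, (w + 1 - b) * (binCoeff n b / (n + (w + 1))) -
      w * (binCoeff n b / (n + w)) = T n - T (n + 1) := fun n => by
    have h1 := hne n
    have h2 := hne (n + 1)
    have h3 : (n : ℂ) + 1 ≠ 0 := Nat.cast_add_one_ne_zero n
    push_cast at h2
    have h4 : (n : ℂ) + (w + 1) ≠ 0 := by rwa [show (n : ℂ) + (w + 1) = n + 1 + w by ring]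
    simp only [hT, binCoeff_succ]
    push_cast
    field_simp
    ring
  have hT0 : Tendsto T atTop (𝓝 0) := by
    have h1 : T = fun n => binCoeff n b - w * (binCoeff n b / (n + w)) := by
      funext n
      have := hne n
      simp only [hT]
      field_simp
      ring
    rw [h1]
    simpa using (tendsto_binCoeff hb).sub (hs1.tendsto_atTop_zero.const_mul w)
  have hsum := ((hs2.mul_left (w + 1 - b)).hasSum.sub (hs1.mul_left w).hasSum)
  have hlim := hsum.tendsto_sum_nat
  simp only [hterm, Finset.sum_range_sub'] at hlim
  have hlim2 : Tendsto (fun n => T 0 - T n) atTop (𝓝 0) := by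
    have h0 : T 0 = 0 := by simp [hT]
    simpa [h0] using hT0.const_sub (T 0)
  have := tendsto_nhds_unique hlim hlim2
  rw [tsum_mul_left, tsum_mul_left] at this
  linear_combination -this

/-- The analytic continuation in `w` of the beta integral, by downward recursion on `Re w`. -/
lemma tsum_binCoeff_div {b : ℂ} (hb : b.re < 1) {w : ℂ} (hw : ∀ k : ℕ, w ≠ -k) :
    ∑' n : ℕ, binCoeff n b / (n + w) =
      Complex.Gamma w * Complex.Gamma (1 - b) / Complex.Gamma (w + 1 - b) := by
  obtain ⟨m, hm⟩ := exists_nat_gt (-w.re)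
  induction m generalizing w with
  | zero => exact (hasSum_binCoeff_div_of_re_pos hb (by simpa using hm)).tsum_eq
  | succ m ih =>
    have hw0 : w ≠ 0 := by simpa using hw 0
    have h1 := ih (w := w + 1) (fun k hk => hw (k + 1) (by push_cast; linear_combination hk))
      (by push_cast at hm; simp; linarith)
    have h2 := mul_tsum_binCoeff_div hb hw
    have h3 := Complex.one_div_Gamma_eq_self_mul_one_div_Gamma_add_one (w + 1 - b)
    rw [h1, Complex.Gamma_add_one w hw0, show w + 1 + 1 - b = w + 1 - b + 1 by ring] at h2
    rw [div_eq_mul_inv, h3]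
    refine mul_left_cancel₀ hw0 (h2.trans ?_)
    ring

/-- The holomorphic extension of `cFormula`: after the reflection formula for `Γ(a)` and `Γ(b)` and
the duplication formula for `Γ(a + b - 1)`, the poles at `a + b = 0, -2, -4, …` are gone. -/
noncomputable def cExt (p : ℂ × ℂ) : ℂ :=
  Complex.Gamma ((p.1 + p.2 - 1) / 2) * Complex.Gamma (1 - p.1) * Complex.Gamma (1 - p.2) *
    Complex.cos (Real.pi * (p.1 - p.2) / 2) / (2 * Real.pi)

lemma half_ne_neg_natCast {a b : ℂ} (h : (a, b) ∈ paramDomain) (k : ℕ) :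
    (a + b - 1) / 2 ≠ -(k : ℂ) :=
  fun h0 => h.2.2 k (by linear_combination 2 * h0)

lemma one_sub_ne_neg_natCast {a : ℂ} (h : a.re < 1) (k : ℕ) : 1 - a ≠ -(k : ℂ) := fun h0 => by
  have := congrArg Complex.re h0
  simp at this
  linarith [(k.cast_nonneg : (0 : ℝ) ≤ k)]

lemma differentiableAt_cExt {p : ℂ × ℂ} (h : p ∈ paramDomain) : DifferentiableAt ℂ cExt p := by
  have h1 : DifferentiableAt ℂ (fun q : ℂ × ℂ => Complex.Gamma ((q.1 + q.2 - 1) / 2)) p :=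
    (Complex.differentiableAt_Gamma _ (half_ne_neg_natCast h)).comp p
      (f := fun q : ℂ × ℂ => (q.1 + q.2 - 1) / 2) (by fun_prop)
  have h2 : DifferentiableAt ℂ (fun q : ℂ × ℂ => Complex.Gamma (1 - q.1)) p :=
    (Complex.differentiableAt_Gamma _ (one_sub_ne_neg_natCast h.1)).comp p
      (f := fun q : ℂ × ℂ => 1 - q.1) (by fun_prop)
  have h3 : DifferentiableAt ℂ (fun q : ℂ × ℂ => Complex.Gamma (1 - q.2)) p :=
    (Complex.differentiableAt_Gamma _ (one_sub_ne_neg_natCast h.2.1)).comp p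
      (f := fun q : ℂ × ℂ => 1 - q.2) (by fun_prop)
  have h4 : DifferentiableAt ℂ
      (fun q : ℂ × ℂ => Complex.cos (Real.pi * (q.1 - q.2) / 2)) p := by fun_prop
  unfold cExt
  simp only [div_eq_mul_inv _ (2 * (Real.pi : ℂ))]
  exact (((h1.mul h2).mul h3).mul h4).mul_const _

lemma Gamma_one_sub_div_Gamma (a : ℂ) {b : ℂ} (hb : b.re < 1) :
    Complex.Gamma (1 - a) / Complex.Gamma b =
      Complex.Gamma (1 - a) * Complex.Gamma (1 - b) * Complex.sin (Real.pi * b) / Real.pi := by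
  have hpi : (Real.pi : ℂ) ≠ 0 := by exact_mod_cast Real.pi_ne_zero
  have h := Complex.Gamma_mul_Gamma_one_sub b
  have hG : Complex.Gamma (1 - b) ≠ 0 := Complex.Gamma_ne_zero (one_sub_ne_neg_natCast hb)
  by_cases hs : Complex.sin (Real.pi * b) = 0
  · rw [hs, div_zero] at h
    have hb0 : Complex.Gamma b = 0 := (mul_eq_zero.1 h).resolve_right hG
    simp [hs, hb0]
  · have hb0 : Complex.Gamma b ≠ 0 := fun h0 => by
      rw [h0, zero_mul, eq_comm, div_eq_zero_iff] at h
      exact h.elim hpi hs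
    rw [eq_div_iff hs] at h
    rw [div_eq_div_iff hb0 hpi]
    linear_combination -Complex.Gamma (1 - a) * h

lemma cFormula_eq_cExt {a b : ℂ} (h : (a, b) ∈ paramDomain) (h0 : ∀ k : ℕ, a + b ≠ -2 * (k : ℂ)) :
    cFormula a b = cExt (a, b) := by
  obtain ⟨ha, hb, -⟩ := id h
  simp only at ha hb
  have hpi : (Real.pi : ℂ) ≠ 0 := by exact_mod_cast Real.pi_ne_zero
  have hsq : (Real.sqrt Real.pi : ℂ) ^ 2 = Real.pi := by
    rw [← Complex.ofReal_pow, Real.sq_sqrt Real.pi_pos.le]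
  have hsq0 : (Real.sqrt Real.pi : ℂ) ≠ 0 := fun h => hpi (by rw [← hsq, h]; simp)
  have hdup := Complex.Gamma_mul_Gamma_add_half ((a + b - 1) / 2)
  rw [show (a + b - 1) / 2 + 1 / 2 = (a + b) / 2 by ring,
    show 2 * ((a + b - 1) / 2) = a + b - 1 by ring,
    show 1 - (a + b - 1) = 2 + (-a - b) by ring, Complex.cpow_add _ _ two_ne_zero,
    Complex.cpow_ofNat] at hdup
  have hrefl := Complex.Gamma_mul_Gamma_one_sub ((a + b) / 2)
  have hG1 : Complex.Gamma ((a + b) / 2) ≠ 0 :=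
    Complex.Gamma_ne_zero fun k hk => h0 k (by linear_combination 2 * hk)
  have hG2 : Complex.Gamma (1 - (a + b) / 2) ≠ 0 :=
    Complex.Gamma_ne_zero fun k hk => by
      have := congrArg Complex.re hk
      simp at this
      linarith [(k.cast_nonneg : (0 : ℝ) ≤ k)]
  have hsin : Complex.sin (Real.pi * ((a + b) / 2)) ≠ 0 := fun hs => by
    rw [hs, div_zero] at hrefl
    exact (mul_ne_zero hG1 hG2) hrefl
  rw [eq_div_iff hsin] at hrefl
  have hss := Complex.sin_add_sin (Real.pi * b) (Real.pi * a)
  rw [show (Real.pi * b + Real.pi * a : ℂ) / 2 = Real.pi * ((a + b) / 2) by ring,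
    ← Complex.cos_neg,
    show -((Real.pi * b - Real.pi * a : ℂ) / 2) = Real.pi * (a - b) / 2 by ring] at hss
  have hdiv1 := Gamma_one_sub_div_Gamma a hb
  have hdiv2 := Gamma_one_sub_div_Gamma b ha
  have hsum : Complex.Gamma (1 - a) / Complex.Gamma b + Complex.Gamma (1 - b) / Complex.Gamma a =
      Complex.Gamma (1 - a) * Complex.Gamma (1 - b) *
        (2 * Complex.sin (Real.pi * ((a + b) / 2)) * Complex.cos (Real.pi * (a - b) / 2)) /
          Real.pi := by
    rw [hdiv1, hdiv2, ← hss]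
    ring
  unfold cFormula cExt
  rw [hsum, show (2 - a - b) / 2 = 1 - (a + b) / 2 by ring]
  simp only
  set P := (2 : ℂ) ^ (-a - b)
  set r := (Real.sqrt Real.pi : ℂ)
  set X := Complex.Gamma (a + b - 1)
  set Y := Complex.Gamma ((a + b - 1) / 2)
  set U := Complex.Gamma ((a + b) / 2)
  set V := Complex.Gamma (1 - (a + b) / 2)
  set S := Complex.sin (Real.pi * ((a + b) / 2))
  set A := Complex.Gamma (1 - a)
  set B := Complex.Gamma (1 - b)
  set D := Complex.cos (Real.pi * (a - b) / 2)
  rw [← hsq] at hrefl ⊢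
  field_simp
  -- the two sides differ by multiples of the duplication and the reflection formula
  have hPX : P * X * r * 4 = Y * U := by linear_combination -hdup
  refine mul_left_cancel₀ hsq0 (mul_left_cancel₀ hsq0 ?_)
  linear_combination (r * V * A * B * S * D) * hPX + (r * Y * A * B * D) * hrefl

lemma neg_tsum_coeff_mul_momentConst {a b : ℂ} (h : (a, b) ∈ paramDomain)
    (h0 : ∀ k : ℕ, a + b ≠ -2 * (k : ℂ)) :
    -(∑' n, coeff n (a, b)) * momentConst (1 - a - b) = cFormula a b := by
  obtain ⟨ha, hb, -⟩ := id h
  simp only at ha hb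
  have hw : ∀ k : ℕ, a + b - 1 ≠ -(k : ℂ) := fun k hk => by
    obtain ⟨j, rfl | rfl⟩ := k.even_or_odd'
    · exact h.2.2 j (by push_cast at hk; linear_combination hk)
    · exact h0 j (by push_cast at hk; linear_combination hk)
  have hterm : ∀ n : ℕ, coeff n (a, b) =
      -(binCoeff n a / (n + (a + b - 1)) + binCoeff n b / (n + (a + b - 1))) := fun n => by
    have h1 := mul_coeff h n
    have h2 : (n : ℂ) + (a + b - 1) ≠ 0 := fun h2 => hw n (by linear_combination h2)
    rw [← add_div, ← h1]
    field_simp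
    ring
  simp only [hterm]
  rw [tsum_neg, neg_neg, (summable_binCoeff_div ha _).tsum_add (summable_binCoeff_div hb _),
    tsum_binCoeff_div ha hw, tsum_binCoeff_div hb hw,
    show a + b - 1 + 1 - a = b by ring, show a + b - 1 + 1 - b = a by ring]
  unfold momentConst cFormula
  rw [show 1 - a - b - 1 = -a - b by ring, show (1 + (1 - a - b)) / 2 = (2 - a - b) / 2 by ring]
  ring

/-! ### The parameter domain and the exceptional lines -/

lemma isOpen_paramDomain : IsOpen paramDomain := by
  have h : paramDomain = {p : ℂ × ℂ | p.1.re < 1} ∩ ({p : ℂ × ℂ | p.2.re < 1} ∩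
      {p : ℂ × ℂ | (Complex.Gamma ((p.1 + p.2 - 1) / 2))⁻¹ ≠ 0}) := by
    ext ⟨a, b⟩
    simp only [paramDomain, Set.mem_ofPred_eq, Set.mem_inter_iff, ne_eq, inv_eq_zero,
      Complex.Gamma_eq_zero_iff, not_exists]
    refine and_congr_right fun _ => and_congr_right fun _ => forall_congr' fun k => ?_
    refine not_congr ⟨fun hk => by linear_combination hk / 2, fun hk => by
      linear_combination 2 * hk⟩
  have hc : Continuous fun p : ℂ × ℂ => (Complex.Gamma ((p.1 + p.2 - 1) / 2))⁻¹ :=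
    Complex.differentiable_one_div_Gamma.continuous.comp
      (g := fun s : ℂ => (Complex.Gamma s)⁻¹) (by fun_prop)
  rw [h]
  exact (isOpen_lt (by fun_prop) continuous_const).inter
    ((isOpen_lt (by fun_prop) continuous_const).inter (isOpen_ne_fun hc continuous_const))

/-- The distance conditions of a region can be tested by moving one coordinate only. -/
lemma inRegion_of_dist {R δ : ℝ} {a b : ℂ} (h : (a, b) ∈ paramDomain) (ha : ‖a‖ ≤ R)
    (hb : ‖b‖ ≤ R) (h1 : ∀ a', (a', b) ∉ paramDomain → δ ≤ ‖a' - a‖)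
    (h2 : ∀ b', (a, b') ∉ paramDomain → δ ≤ ‖b' - b‖) : InRegion R δ a b := by
  have hare : a.re < 1 := h.1
  have hbre : b.re < 1 := h.2.1
  refine ⟨ha, hb, ?_, ?_, fun k => ?_⟩
  · have := h1 (a + (1 - a.re : ℝ)) fun hm => by
      have h3 : (a + (1 - a.re : ℝ)).re < 1 := hm.1
      simp at h3
    rw [add_sub_cancel_left, Complex.norm_real, Real.norm_of_nonneg (by linarith)] at this
    linarith
  · have := h2 (b + (1 - b.re : ℝ)) fun hm => by
      have h3 : (b + (1 - b.re : ℝ)).re < 1 := hm.2.1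
      simp at h3
    rw [add_sub_cancel_left, Complex.norm_real, Real.norm_of_nonneg (by linarith)] at this
    linarith
  · have := h1 (a + (1 - a - b - 2 * k)) fun hm => hm.2.2 k (by simp only; ring)
    rwa [add_sub_cancel_left] at this

lemma exists_inRegion {a b : ℂ} (h : (a, b) ∈ paramDomain) :
    ∃ R δ : ℝ, 0 < δ ∧ δ < 1 / 2 ∧ InRegion R δ a b := by
  obtain ⟨ε, hε, hball⟩ := Metric.isOpen_iff.1 isOpen_paramDomain _ h
  refine ⟨max ‖a‖ ‖b‖, min ε (1 / 3), lt_min hε (by norm_num),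
    (min_le_right _ _).trans_lt (by norm_num),
    inRegion_of_dist h (le_max_left _ _) (le_max_right _ _) (fun a' ha' => ?_) fun b' hb' => ?_⟩
  · by_contra! hlt
    refine ha' (hball ?_)
    rw [Metric.mem_ball, Prod.dist_eq, dist_self, dist_eq_norm]
    exact max_lt (hlt.trans_le (min_le_left _ _)) hε
  · by_contra! hlt
    refine hb' (hball ?_)
    rw [Metric.mem_ball, Prod.dist_eq, dist_self, dist_eq_norm]
    exact max_lt hε (hlt.trans_le (min_le_left _ _))

lemma inRegion_of_le_distToCompl {R δ : ℝ} {a b : ℂ} (h : (a, b) ∈ paramDomain)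
    (hR : pairNorm (a, b) ≤ R) (hδ : δ ≤ distToCompl (a, b)) : InRegion R δ a b := by
  have hle : ∀ x y : ℂ, ‖x‖ ≤ pairNorm (x, y) ∧ ‖y‖ ≤ pairNorm (x, y) := fun x y => by
    have h1 := WithLp.prod_norm_sq_eq_of_L2 (WithLp.toLp 2 (x, y))
    unfold pairNorm
    exact ⟨le_of_sq_le_sq (by rw [h1]; exact le_add_of_nonneg_right (sq_nonneg _)) (norm_nonneg _),
      le_of_sq_le_sq (by rw [h1]; exact le_add_of_nonneg_left (sq_nonneg _)) (norm_nonneg _)⟩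
  have hdist : ∀ q ∉ paramDomain, δ ≤ dist (WithLp.toLp 2 (a, b)) (WithLp.toLp 2 q) :=
    fun q hq => hδ.trans (Metric.infDist_le_dist_of_mem ⟨q, hq, rfl⟩)
  refine inRegion_of_dist h ((hle a b).1.trans hR) ((hle a b).2.trans hR) (fun a' ha' => ?_)
    fun b' hb' => ?_
  · have := hdist _ ha'
    rw [WithLp.prod_dist_eq_of_L2] at this
    change δ ≤ Real.sqrt (dist a a' ^ 2 + dist b b ^ 2) at this
    rwa [dist_self, zero_pow two_ne_zero, add_zero,
      Real.sqrt_sq dist_nonneg, dist_comm, dist_eq_norm] at this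
  · have := hdist _ hb'
    rw [WithLp.prod_dist_eq_of_L2] at this
    change δ ≤ Real.sqrt (dist a a ^ 2 + dist b b' ^ 2) at this
    rwa [dist_self, zero_pow two_ne_zero, zero_add,
      Real.sqrt_sq dist_nonneg, dist_comm, dist_eq_norm] at this

/-- At the points with `a + b = 0, -2, …` the identity follows by continuity in `b`, the series
having a uniform majorant. -/
lemma neg_tsum_coeff_mul_momentConst_eq_cExt {a b : ℂ} (h : (a, b) ∈ paramDomain) :
    -(∑' n, coeff n (a, b)) * momentConst (1 - a - b) = cExt (a, b) := by
  by_cases hex : ∀ k : ℕ, a + b ≠ -2 * (k : ℂ)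
  · rw [neg_tsum_coeff_mul_momentConst h hex, cFormula_eq_cExt h hex]
  push Not at hex
  obtain ⟨k, hk⟩ := hex
  obtain ⟨R, δ, hδ0, hδ, hr⟩ := exists_inRegion h
  obtain ⟨C, hC⟩ := exists_majorant_coeff (R + 1)
  obtain ⟨u, hu, -, hbound⟩ := hC (δ / 2) (by linarith) (by linarith)
  have hnear : ∀ᶠ b' in 𝓝 b, InRegion (R + 1) (δ / 2) a b' := by
    filter_upwards [Metric.ball_mem_nhds b (show 0 < δ / 2 by linarith)] with b' hb'
    rw [Metric.mem_ball, dist_eq_norm] at hb'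
    refine ⟨by linarith [hr.norm_left], ?_, by linarith [hr.re_left], ?_, fun k => ?_⟩
    · calc ‖b'‖ = ‖b + (b' - b)‖ := by congr 1; ring
        _ ≤ ‖b‖ + ‖b' - b‖ := norm_add_le _ _
        _ ≤ _ := by linarith [hr.norm_right]
    · have h1 := (Complex.re_le_norm (b' - b)).trans hb'.le
      rw [Complex.sub_re] at h1
      linarith [hr.re_right]
    · have h1 : ‖1 - a - b - 2 * (k : ℂ)‖ ≤ ‖1 - a - b' - 2 * (k : ℂ)‖ + ‖b' - b‖ := by
        calc _ = ‖(1 - a - b' - 2 * (k : ℂ)) + (b' - b)‖ := by congr 1; ring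
          _ ≤ _ := norm_add_le _ _
      linarith [hr.le_norm k]
  have hdom : ∀ᶠ b' in 𝓝 b, (a, b') ∈ paramDomain :=
    hnear.mono fun b' hb' => hb'.mem (by linarith)
  have hline : Continuous fun b' : ℂ => (a, b') := by fun_prop
  have hlim1 : Tendsto (fun b' => ∑' n, coeff n (a, b')) (𝓝 b) (𝓝 (∑' n, coeff n (a, b))) := by
    refine tendsto_tsum_of_dominated_convergence hu (fun n => ?_)
      (hnear.mono fun b' hb' => hbound a b' hb')
    exact Tendsto.comp (((differentiableOn_coeff n).differentiableAt
      (isOpen_paramDomain.mem_nhds h)).continuousAt) hline.continuousAt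
  have hlim2 : Tendsto (fun b' => momentConst (1 - a - b')) (𝓝 b)
      (𝓝 (momentConst (1 - a - b))) := by
    have hG : ContinuousAt (fun b' : ℂ => Complex.Gamma ((1 + (1 - a - b')) / 2)) b := by
      refine ContinuousAt.comp (g := Complex.Gamma) (f := fun b' : ℂ => (1 + (1 - a - b')) / 2)
        (Complex.differentiableAt_Gamma _ fun k hk => ?_).continuousAt
        (Continuous.continuousAt (by fun_prop))
      have h1 : a.re < 1 := h.1
      have h2 : b.re < 1 := h.2.1
      have h3 : 1 + (1 - a - b) = -2 * (k : ℂ) := by linear_combination 2 * hk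
      have := congrArg Complex.re h3
      simp at this
      linarith [(k.cast_nonneg : (0 : ℝ) ≤ k)]
    have hP : ContinuousAt (fun b' : ℂ => (2 : ℂ) ^ (1 - a - b' - 1)) b :=
      (ContinuousAt.const_cpow (Continuous.continuousAt (by fun_prop)) (Or.inl two_ne_zero))
    exact (hP.mul hG).div_const _
  have hlim3 : Tendsto (fun b' => cExt (a, b')) (𝓝 b) (𝓝 (cExt (a, b))) :=
    Tendsto.comp (differentiableAt_cExt h).continuousAt hline.continuousAt
  have heq : ∀ᶠ b' in 𝓝[≠] b,
      -(∑' n, coeff n (a, b')) * momentConst (1 - a - b') = cExt (a, b') := by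
    -- the exceptional lines are at mutual distance `2`
    filter_upwards [hdom.filter_mono nhdsWithin_le_nhds, self_mem_nhdsWithin,
      mem_nhdsWithin_of_mem_nhds (Metric.ball_mem_nhds b one_pos)] with b' hb' hne hball
    have hk' : ∀ j : ℕ, a + b' ≠ -2 * (j : ℂ) := fun j hj => by
      rw [Metric.mem_ball, dist_eq_norm] at hball
      have h1 : b' - b = ((2 * ((k : ℤ) - j) : ℤ) : ℂ) := by
        push_cast; linear_combination hj - hk
      rw [h1, Complex.norm_intCast] at hball
      have h2 : |2 * ((k : ℤ) - j)| < 1 := by exact_mod_cast hball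
      rw [Int.abs_lt_one_iff] at h2
      rw [h2, Int.cast_zero, sub_eq_zero] at h1
      exact hne h1
    rw [neg_tsum_coeff_mul_momentConst hb' hk', cFormula_eq_cExt hb' hk']
  exact tendsto_nhds_unique
    (((hlim1.neg.mul hlim2).mono_left nhdsWithin_le_nhds).congr' heq)
    (hlim3.mono_left nhdsWithin_le_nhds)

/-! ### The estimates -/

lemma coeff_mul_momentConst_eq_cnFormula {a b : ℂ} (h : (a, b) ∈ paramDomain) {n : ℕ}
    (hn : 1 - a - b - (n : ℂ) ≠ 0) :
    coeff n (a, b) * momentConst n = cnFormula n a b := by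
  have h1 := mul_coeff h n
  have h2 : coeff n (a, b) = (binCoeff n a + binCoeff n b) / (1 - a - b - n) := by
    rw [← h1]; field_simp
  have h3 : (2 : ℂ) ^ ((n : ℂ) - 1) = (2 : ℂ) ^ ((n : ℤ) - 1) := by
    rw [← Complex.cpow_intCast]; push_cast; rfl
  have hf : (n.factorial : ℂ) ≠ 0 := by exact_mod_cast n.factorial_ne_zero
  have hpi : (Real.sqrt Real.pi : ℂ) ≠ 0 := by
    exact_mod_cast (Real.sqrt_pos.2 Real.pi_pos).ne'
  rw [h2, momentConst, h3, cnFormula, binCoeff, binCoeff]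
  field_simp

/-- The remainder estimate, uniform on each region, with a constant of order `1 / δ`. -/
lemma exists_remainder_le (R : ℝ) (N : ℕ) : ∃ C : ℝ, 0 ≤ C ∧ ∀ δ : ℝ, 0 < δ → δ < 1 / 2 →
    ∀ a b : ℂ, InRegion R δ a b → -(a + b).re ≤ N → ∀ t : ℝ, 0 < t →
      remainder cExt (fun n p => coeff n p * momentConst n) N a b t ≤
        C / δ * t ^ (((N : ℝ) + 1) / 2) := by
  obtain ⟨C, hC⟩ := exists_majorant_coeff R
  refine ⟨2 * |C| * ‖momentConst (N + 1 : ℕ)‖, by positivity, fun δ h0 hδ a b hr hN t ht => ?_⟩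
  obtain ⟨u, hu, huC, hbound⟩ := hC δ h0 hδ
  have hsum : Summable fun n => ‖coeff n (a, b)‖ :=
    Summable.of_nonneg_of_le (fun n => norm_nonneg _) (hbound a b hr) hu
  have hle : ∑' n, ‖coeff n (a, b)‖ ≤ |C| / δ :=
    ((hsum.tsum_le_tsum (hbound a b hr) hu).trans huC).trans (by gcongr; exact le_abs_self C)
  have h := norm_heatContent_sub_le (hr.mem h0) hN hsum ht
  rw [neg_tsum_coeff_mul_momentConst_eq_cExt (hr.mem h0)] at h
  refine h.trans ?_
  calc _ ≤ 2 * (|C| / δ) * (‖momentConst (N + 1 : ℕ)‖ * t ^ (((N : ℝ) + 1) / 2)) := by gcongr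
    _ = _ := by ring

end HeatContent

theorem theorem3p1 :
    ∃ (c : ℂ × ℂ → ℂ) (cn : ℕ → ℂ × ℂ → ℂ),
      -- `c` is the holomorphic extension to the whole domain of its explicit formula
      (DifferentiableOn ℂ c paramDomain ∧
        ∀ a b : ℂ, (a, b) ∈ paramDomain → (∀ k : ℕ, a + b ≠ -2 * (k : ℂ)) →
          c (a, b) = cFormula a b) ∧
      -- and so is each `c_n`
      (∀ n : ℕ, DifferentiableOn ℂ (cn n) paramDomain ∧
        ∀ a b : ℂ, (a, b) ∈ paramDomain → 1 - a - b - (n : ℂ) ≠ 0 →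
          cn n (a, b) = cnFormula n a b) ∧
      -- the uniform estimate
      (∀ (N : ℕ) (R : ℝ), ∃ κ : ℝ, ∀ (a b : ℂ) (δ t : ℝ),
        (a, b) ∈ paramDomain → -7 < (a + b).re → -(a + b).re + 3 ≤ (N : ℝ) →
        pairNorm (a, b) ≤ R → 0 < δ → δ < 1 / 2 → δ ≤ distToCompl (a, b) → 0 < t → t < 1 →
          remainder c cn N a b t ≤
            κ * (1 + δ ^ (-4 : ℤ)) * (t ^ (((N : ℝ) + 1) / 2) + Real.exp (-1 / (36 * t)))) ∧
      -- the pointwise estimate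
      (∀ (N : ℕ) (a b : ℂ),
        (a, b) ∈ paramDomain → (a + b).re ≤ -7 → -(a + b).re + 3 ≤ (N : ℝ) →
          ∃ E : ℝ, ∀ t : ℝ, 0 < t → t < 1 →
            remainder c cn N a b t ≤ E * t ^ (((N : ℝ) + 1) / 2)) := by
  refine ⟨HeatContent.cExt, fun n p => HeatContent.coeff n p * HeatContent.momentConst n,
    ⟨fun p hp => (HeatContent.differentiableAt_cExt hp).differentiableWithinAt,
      fun a b h h0 => (HeatContent.cFormula_eq_cExt h h0).symm⟩,
    fun n => ⟨(HeatContent.differentiableOn_coeff n).mul_const _,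
      fun a b h hn => HeatContent.coeff_mul_momentConst_eq_cnFormula h hn⟩,
    fun N R => ?_, fun N a b h _ hN => ?_⟩
  · obtain ⟨C, hC0, hC⟩ := HeatContent.exists_remainder_le R N
    refine ⟨C, fun a b δ t h _ hN hR h0 hδ hdist ht _ => ?_⟩
    have hr := HeatContent.inRegion_of_le_distToCompl h hR hdist
    refine (hC δ h0 hδ a b hr (by linarith) t ht).trans ?_
    have h1 : δ⁻¹ ≤ δ ^ (-4 : ℤ) := by
      rw [← zpow_neg_one]
      exact zpow_le_zpow_right_of_le_one₀ h0 (by linarith) (by norm_num)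
    have h2 : 0 ≤ Real.exp (-1 / (36 * t)) := (Real.exp_pos _).le
    rw [div_eq_mul_inv]
    gcongr
    · linarith
    · linarith
  · obtain ⟨R, δ, h0, hδ, hr⟩ := HeatContent.exists_inRegion h
    obtain ⟨C, -, hC⟩ := HeatContent.exists_remainder_le R N
    exact ⟨C / δ, fun t ht _ => hC δ h0 hδ a b hr (by linarith) t ht⟩
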